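/- For integers $k\ge 0$ and $n\ge 1$, the $k$-path power on $n$ vertices is the graph with vertices $v_1,\dots,v_n$ in which, for $1\le i<j\le n$, the vertices $v_i$ and $v_j$ are adjacent if and only if $j-i\le k$. Let $Z_k$ be the $k$-path power on $k(k+1)+2$ vertices. A $k$-expression builds a vertex-labelled graph with labels from $\{1,\dots,k\}$ by the following operations: creating a single labelled vertex; disjoint union of two labelled graphs; joining all vertices with label $i$ to all vertices with label $j$, where $i\ne j$; changing every label $i$ into $j$. It is linear if in every union at least one operand creates a single labelled vertex. The clique-width $\mathrm{cwd}(G)$ (linear clique-width $\mathrm{lcwd}(G)$) of a graph $G$ is the smallest $k$ such that $G$ is defined by a $k$-expression (by a linear $k$-expression); both are $0$ for the graph without vertices. Then for every $k\ge 0$, every proper induced subgraph of $Z_k$ has linear clique-width at most $k+1$. Moreover, for every $k\ge 1$, $\mathrm{cwd}(Z_k)\ge k+2$, and $Z_k$ is a minimal forbidden induced subgraph for the class of graphs of clique-width at most $k+1$ as well as for the class of graphs of linear clique-width at most $k+1$; that is, $Z_k$ is not in the class, but every proper induced subgraph of $Z_k$ is. -/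

import Mathlib

/-- The `k`-path power on `n` vertices, with `k`-path layout `0, 1, …, n - 1`: for `i < j`, the
vertices `i` and `j` are adjacent if and only if `j - i ≤ k`. -/
def pathPower (k n : ℕ) : SimpleGraph (Fin n) :=
  SimpleGraph.fromRel fun i j => i < j ∧ (j : ℕ) ≤ (i : ℕ) + k

/-- The graph `Z_k`: the `k`-path power on `k (k + 1) + 2` vertices. -/
def graphZ (k : ℕ) : SimpleGraph (Fin (k * (k + 1) + 2)) :=
  pathPower k (k * (k + 1) + 2)

/-- Syntax of clique-width expressions with labels from `Fin k`; the vertices that an expression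
creates are named by elements of `V`. -/
inductive CliqueExpr (V : Type*) (k : ℕ) where
  /-- create the vertex `v` with label `i` -/
  | vertex (i : Fin k) (v : V) : CliqueExpr V k
  /-- disjoint union of two labelled graphs -/
  | union (e f : CliqueExpr V k) : CliqueExpr V k
  /-- add all edges between vertices with label `i` and vertices with label `j` -/
  | join (i j : Fin k) (e : CliqueExpr V k) : CliqueExpr V k
  /-- change every label `i` into label `j` -/
  | relabel (i j : Fin k) (e : CliqueExpr V k) : CliqueExpr V k

namespace CliqueExpr

variable {V : Type*} {k : ℕ}

/-- The vertex set of the labelled graph defined by an expression. -/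
def verts : CliqueExpr V k → Set V
  | vertex _ v => {v}
  | union e f => e.verts ∪ f.verts
  | join _ _ e => e.verts
  | relabel _ _ e => e.verts

/-- `e.HasLabel u a`: the vertex `u` of the labelled graph defined by `e` has label `a`. -/
def HasLabel : CliqueExpr V k → V → Fin k → Prop
  | vertex i v, u, a => u = v ∧ a = i
  | union e f, u, a => e.HasLabel u a ∨ f.HasLabel u a
  | join _ _ e, u, a => e.HasLabel u a
  | relabel i j e, u, a => (e.HasLabel u a ∧ a ≠ i) ∨ (e.HasLabel u i ∧ a = j)

/-- The edges of the labelled graph defined by an expression, as a graph on all of `V`. -/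
def graph : CliqueExpr V k → SimpleGraph V
  | vertex _ _ => ⊥
  | union e f => e.graph ⊔ f.graph
  | join i j e => e.graph ⊔ SimpleGraph.fromRel fun u w => e.HasLabel u i ∧ e.HasLabel w j
  | relabel _ _ e => e.graph

/-- An expression is well formed if all its unions are disjoint (so that no vertex is created
twice) and all its joins are between two distinct labels. -/
def WellFormed : CliqueExpr V k → Prop
  | vertex _ _ => True
  | union e f => e.WellFormed ∧ f.WellFormed ∧ Disjoint e.verts f.verts
  | join i j e => i ≠ j ∧ e.WellFormed
  | relabel _ _ e => e.WellFormed

/-- The expression creates a single labelled vertex. -/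
def IsVertex (e : CliqueExpr V k) : Prop :=
  ∃ (i : Fin k) (v : V), e = vertex i v

/-- An expression is linear if in each of its unions at least one of the two operands creates a
single labelled vertex. -/
def IsLinear : CliqueExpr V k → Prop
  | vertex _ _ => True
  | union e f => e.IsLinear ∧ f.IsLinear ∧ (e.IsVertex ∨ f.IsVertex)
  | join _ _ e => e.IsLinear
  | relabel _ _ e => e.IsLinear

/-- The well-formed expression `e` defines (up to the labels) the graph `G`. -/
def Defines (e : CliqueExpr V k) (G : SimpleGraph V) : Prop :=
  e.WellFormed ∧ e.verts = Set.univ ∧ e.graph = G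

end CliqueExpr

/-- The clique-width of `G`: the smallest `k` such that some `k`-expression defines `G`. The graph
without vertices has clique-width `0`; a graph without any expression has clique-width `⊤`. -/
noncomputable def cliqueWidth {V : Type*} (G : SimpleGraph V) : ℕ∞ :=
  sInf {m : ℕ∞ | ∃ k : ℕ, m = k ∧ (IsEmpty V ∨ ∃ e : CliqueExpr V k, e.Defines G)}

/-- The linear clique-width of `G`: the smallest `k` such that some linear `k`-expression defines
`G`. The graph without vertices has linear clique-width `0`. -/
noncomputable def linearCliqueWidth {V : Type*} (G : SimpleGraph V) : ℕ∞ :=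
  sInf {m : ℕ∞ | ∃ k : ℕ, m = k ∧
    (IsEmpty V ∨ ∃ e : CliqueExpr V k, e.IsLinear ∧ e.Defines G)}

/-- `G` is a minimal forbidden induced subgraph for the class of the graphs with property `P`:
it is not in the class, but all its proper induced subgraphs are. -/
def IsMinimalForbiddenInducedSubgraph (P : ∀ {W : Type}, SimpleGraph W → Prop)
    {V : Type} (G : SimpleGraph V) : Prop :=
  ¬ P G ∧ ∀ S : Set V, S ≠ Set.univ → P (G.induce S)

/-!
For the upper bound, delete a vertex `x` of `Z_k` and cut the remaining vertices into columns of
consecutive vertices. They can be created one at a time, diagonal by diagonal on either side of `x`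
(row by row if `x` is an end vertex), in such an order that at each moment the vertices created so
far have at most `k` different neighbourhoods among the vertices still to come; one of the `k + 1`
labels is then free for the next vertex.

For the lower bound with `k ≥ 2`, suppose that an expression with at most `k + 1` labels defines
`Z_k`. By induction, a subexpression that creates `k + 1` consecutive vertices misses `k`
consecutive inner vertices, which is absurd for the whole expression. Consider a union. If one
operand already creates `k + 1` consecutive vertices, then by induction it misses `k` others and
hence uses all the labels, and the other operand can only create end vertices of the path. If
neither does, then the operands are the two colours of a partial colouring without monochromatic
interval of `k + 1` vertices, and vertices with the same label are twins: they have the same colour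
and the same neighbours outside their colour. At most `k + 1` classes of twins leave room only for
an arrangement of step-`k` chains of twins that does not fit into `k (k + 1) + 2` vertices.
-/

namespace CliqueExpr

variable {V : Type*} {K : ℕ} {G : SimpleGraph V} {e f : CliqueExpr V K} {u w : V} {a b : Fin K}

theorem mem_verts_iff_exists_hasLabel : u ∈ e.verts ↔ ∃ a, e.HasLabel u a := by
  induction e with
  | vertex _ _ => simp [verts, HasLabel]
  | union _ _ ihe ihf => simp [verts, HasLabel, ihe, ihf, exists_or]
  | join _ _ _ ih => exact ih
  | relabel i j _ ih =>
    refine ih.trans ⟨fun ⟨a, ha⟩ => ?_, ?_⟩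
    · by_cases hai : a = i
      · exact ⟨j, Or.inr ⟨hai ▸ ha, rfl⟩⟩
      · exact ⟨a, Or.inl ⟨ha, hai⟩⟩
    · rintro ⟨a, ha | ha⟩
      exacts [⟨a, ha.1⟩, ⟨i, ha.1⟩]

theorem HasLabel.mem_verts (h : e.HasLabel u a) : u ∈ e.verts :=
  mem_verts_iff_exists_hasLabel.2 ⟨a, h⟩

theorem HasLabel.unique (he : e.WellFormed) (ha : e.HasLabel u a) (hb : e.HasLabel u b) :
    a = b := by
  induction e generalizing a b with
  | vertex _ _ => exact ha.2.trans hb.2.symm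
  | union _ _ ihe ihf =>
    obtain ⟨he, hf, hd⟩ := he
    rcases ha with ha | ha <;> rcases hb with hb | hb
    · exact ihe he ha hb
    · exact (Set.disjoint_left.1 hd ha.mem_verts hb.mem_verts).elim
    · exact (Set.disjoint_left.1 hd hb.mem_verts ha.mem_verts).elim
    · exact ihf hf ha hb
  | join _ _ _ ih => exact ih he.2 ha hb
  | relabel _ _ _ ih =>
    rcases ha with ⟨ha, hai⟩ | ⟨ha, rfl⟩ <;> rcases hb with ⟨hb, hbi⟩ | ⟨hb, rfl⟩
    · exact ih he ha hb
    · exact (hai (ih he ha hb)).elim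
    · exact (hbi (ih he hb ha)).elim
    · rfl

theorem mem_verts_of_adj (h : e.graph.Adj u w) : u ∈ e.verts ∧ w ∈ e.verts := by
  induction e with
  | vertex _ _ => exact h.elim
  | union _ _ ihe ihf =>
    exact h.elim (fun h => (ihe h).imp Or.inl Or.inl) (fun h => (ihf h).imp Or.inr Or.inr)
  | join _ _ _ ih =>
    rcases h with h | ⟨-, ⟨hu, hw⟩ | ⟨hw, hu⟩⟩
    exacts [ih h, ⟨hu.mem_verts, hw.mem_verts⟩, ⟨hu.mem_verts, hw.mem_verts⟩]
  | relabel _ _ _ ih => exact ih h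

/-! ### Restriction to a set of vertices -/

/-- `e'` defines the labelled subgraph of the labelled graph of `e` that is induced by `S`, and is
well formed, linear, or a single vertex if `e` is. -/
structure IsRestriction (S : Set V) (e : CliqueExpr V K) (e' : CliqueExpr S K) : Prop where
  hasLabel_iff : ∀ u a, e'.HasLabel u a ↔ e.HasLabel u a
  adj_iff : ∀ u w, e'.graph.Adj u w ↔ e.graph.Adj u w
  wellFormed : e.WellFormed → e'.WellFormed
  isLinear : e.IsLinear → e'.IsLinear
  isVertex : e.IsVertex → e'.IsVertex

namespace IsRestriction

variable {S : Set V} {e' f' : CliqueExpr S K}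

theorem mem_verts_iff (h : IsRestriction S e e') (u : S) : u ∈ e'.verts ↔ (u : V) ∈ e.verts := by
  simp only [mem_verts_iff_exists_hasLabel, h.hasLabel_iff]

theorem vertex (i : Fin K) (v : S) : IsRestriction S (vertex i v) (.vertex i v) where
  hasLabel_iff u a := by simp [HasLabel, Subtype.ext_iff]
  adj_iff u w := by simp [graph]
  wellFormed := id
  isLinear := id
  isVertex _ := ⟨i, v, rfl⟩

theorem join (h : IsRestriction S e e') (i j : Fin K) :
    IsRestriction S (join i j e) (.join i j e') where
  hasLabel_iff := h.hasLabel_iff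
  adj_iff u w := by simp [graph, h.hasLabel_iff, h.adj_iff, Subtype.ext_iff]
  wellFormed := And.imp_right h.wellFormed
  isLinear := h.isLinear
  isVertex := by rintro ⟨_, _, ⟨⟩⟩

theorem relabel (h : IsRestriction S e e') (i j : Fin K) :
    IsRestriction S (relabel i j e) (.relabel i j e') where
  hasLabel_iff u a := by simp [HasLabel, h.hasLabel_iff]
  adj_iff := h.adj_iff
  wellFormed := h.wellFormed
  isLinear := h.isLinear
  isVertex := by rintro ⟨_, _, ⟨⟩⟩

theorem union (he : IsRestriction S e e') (hf : IsRestriction S f f') :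
    IsRestriction S (union e f) (.union e' f') where
  hasLabel_iff u a := by simp [HasLabel, he.hasLabel_iff, hf.hasLabel_iff]
  adj_iff u w := by simp [graph, he.adj_iff, hf.adj_iff]
  wellFormed h := ⟨he.wellFormed h.1, hf.wellFormed h.2.1, Set.disjoint_left.2 fun u hu hu' =>
    Set.disjoint_left.1 h.2.2 ((he.mem_verts_iff u).1 hu) ((hf.mem_verts_iff u).1 hu')⟩
  isLinear h := ⟨he.isLinear h.1, hf.isLinear h.2.1, h.2.2.imp he.isVertex hf.isVertex⟩
  isVertex := by rintro ⟨_, _, ⟨⟩⟩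

theorem union_left (h : IsRestriction S e e') (hf : Disjoint f.verts S) :
    IsRestriction S (.union e f) e' where
  hasLabel_iff u a := (h.hasLabel_iff u a).trans
    (or_iff_left fun hu => Set.disjoint_left.1 hf hu.mem_verts u.2).symm
  adj_iff u w := (h.adj_iff u w).trans
    (or_iff_left fun hu => Set.disjoint_left.1 hf (mem_verts_of_adj hu).1 u.2).symm
  wellFormed hw := h.wellFormed hw.1
  isLinear hl := h.isLinear hl.1
  isVertex := by rintro ⟨_, _, ⟨⟩⟩

theorem union_right (h : IsRestriction S f f') (he : Disjoint e.verts S) :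
    IsRestriction S (.union e f) f' where
  hasLabel_iff u a := (h.hasLabel_iff u a).trans
    (or_iff_right fun hu => Set.disjoint_left.1 he hu.mem_verts u.2).symm
  adj_iff u w := (h.adj_iff u w).trans
    (or_iff_right fun hu => Set.disjoint_left.1 he (mem_verts_of_adj hu).1 u.2).symm
  wellFormed hw := h.wellFormed hw.2.1
  isLinear hl := h.isLinear hl.2.1
  isVertex := by rintro ⟨_, _, ⟨⟩⟩

end IsRestriction

theorem disjoint_verts_or_exists_isRestriction (S : Set V) (e : CliqueExpr V K) :
    Disjoint e.verts S ∨ ∃ e', IsRestriction S e e' := by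
  induction e with
  | vertex i v =>
    by_cases hv : v ∈ S
    · exact Or.inr ⟨_, .vertex i ⟨v, hv⟩⟩
    · exact Or.inl (Set.disjoint_singleton_left.2 hv)
  | join i j _ ih => exact ih.imp_right fun ⟨_, h⟩ => ⟨_, h.join i j⟩
  | relabel i j _ ih => exact ih.imp_right fun ⟨_, h⟩ => ⟨_, h.relabel i j⟩
  | union _ _ ihe ihf =>
    rcases ihe with he | ⟨_, he⟩ <;> rcases ihf with hf | ⟨_, hf⟩
    · exact Or.inl (Set.disjoint_union_left.2 ⟨he, hf⟩)
    · exact Or.inr ⟨_, hf.union_right he⟩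
    · exact Or.inr ⟨_, he.union_left hf⟩
    · exact Or.inr ⟨_, he.union hf⟩

end CliqueExpr

theorem exists_idempotent_apply_eq_iff {α β : Type*} (g : α → β) :
    ∃ f : α → α, (∀ a, f (f a) = f a) ∧ ∀ a b, f a = f b ↔ g a = g b := by
  let f : α → α := fun a => Set.rangeSplitting g ⟨g a, a, rfl⟩
  have hf : ∀ a b, f a = f b ↔ g a = g b := fun a b => by
    exact (Set.rangeSplitting_injective g).eq_iff.trans Subtype.ext_iff
  exact ⟨f, fun a => (hf _ _).2 (Set.apply_rangeSplitting g ⟨g a, a, rfl⟩), hf⟩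

section Neighbors

variable {V : Type*} {G : SimpleGraph V} {P F : Set V} {u w z : V}

/-- The neighbours of `u` in `F`. While a linear expression is evaluated, with `F` the set of the
vertices that are still to come, two vertices may share a label if these sets agree. -/
def neighborsIn (G : SimpleGraph V) (F : Set V) (u : V) : Set V :=
  G.neighborSet u ∩ F

theorem mem_neighborsIn {y : V} : y ∈ neighborsIn G F u ↔ G.Adj u y ∧ y ∈ F :=
  Iff.rfl

theorem neighborsIn_eq_iff :
    neighborsIn G F u = neighborsIn G F w ↔ ∀ y ∈ F, (G.Adj u y ↔ G.Adj w y) := by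
  simp only [Set.ext_iff, mem_neighborsIn, and_congr_left_iff]

theorem neighborsIn_eq_of_subset {F' : Set V} (hF : F' ⊆ F)
    (h : neighborsIn G F u = neighborsIn G F w) : neighborsIn G F' u = neighborsIn G F' w :=
  neighborsIn_eq_iff.2 fun y hy => neighborsIn_eq_iff.1 h y (hF hy)

/-- The labelling `c` of `P` is fine enough for the vertices of `F` to be added later: vertices of
`P` with equal labels have the same neighbours in `F`. -/
def Uniform (G : SimpleGraph V) (P F : Set V) {α : Type*} (c : V → α) : Prop :=
  ∀ u ∈ P, ∀ w ∈ P, c u = c w → neighborsIn G F u = neighborsIn G F w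

theorem uniform_of_adj_imp {α : Type*} {c : V → α}
    (h : ∀ u ∈ P, ∀ w ∈ P, c u = c w → ∀ y ∈ F, G.Adj u y → G.Adj w y) : Uniform G P F c :=
  fun u hu w hw huw => neighborsIn_eq_iff.2 fun y hy =>
    ⟨h u hu w hw huw y hy, h w hw u hu huw.symm y hy⟩

theorem Uniform.mono {α : Type*} {c : V → α} {F' : Set V} (h : Uniform G P F c) (hF : F' ⊆ F) :
    Uniform G P F' c :=
  fun u hu w hw huw => neighborsIn_eq_of_subset hF (h u hu w hw huw)

open Classical in
theorem Uniform.update {α : Type*} {l : V → α} (h : Uniform G P F l) (hz : z ∉ P) {i : α}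
    (hi : ∀ u ∈ P, l u = i → neighborsIn G F u = neighborsIn G F z) :
    Uniform G (insert z P) F (Function.update l z i) := by
  have hne {u} (hu : u ∈ P) : u ≠ z := ne_of_mem_of_not_mem hu hz
  rintro u (rfl | hu) w (rfl | hw) huw
  · rfl
  · rw [Function.update_self, Function.update_of_ne (hne hw)] at huw
    exact (hi w hw huw.symm).symm
  · rw [Function.update_self, Function.update_of_ne (hne hu)] at huw
    exact hi u hu huw
  · rw [Function.update_of_ne (hne hu), Function.update_of_ne (hne hw)] at huw
    exact h u hu w hw huw

/-- The condition under which a vertex `z` can be added to the graph induced by `P` with `k + 1`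
labels, when the vertices of `F` are added later: either the vertices of `P` fall into at most `k`
classes, so that a label is free for `z`, or `z` can be given the label of a vertex of `P`. In the
second case the joins that create the edges at `z` also apply to the vertices with that label. -/
def CanAdd (G : SimpleGraph V) (k : ℕ) (P : Set V) (z : V) (F : Set V) : Prop :=
  (∃ c : V → ℕ, (∀ u ∈ P, c u < k) ∧ Uniform G P (insert z F) c) ∨
  ∃ u ∈ P, neighborsIn G F u = neighborsIn G F z ∧
    ∀ u' ∈ P, neighborsIn G (insert z F) u' = neighborsIn G (insert z F) u →
      neighborsIn G P z ⊆ neighborsIn G P u'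

theorem exists_forall_ne_of_uniform {k : ℕ} {l : V → Fin (k + 1)} {c : V → ℕ}
    (hl : ∀ u ∈ P, ∀ w ∈ P, neighborsIn G F u = neighborsIn G F w → l u = l w)
    (hc : Uniform G P F c) (hck : ∀ u ∈ P, c u < k) : ∃ i, ∀ u ∈ P, l u ≠ i := by
  by_contra! hused
  choose s hs hsl using hused
  obtain ⟨a, b, hab, hcab⟩ := Fintype.exists_ne_map_eq_of_card_lt
    (fun a => (⟨c (s a), hck _ (hs a)⟩ : Fin k)) (by simp)
  apply hab
  rw [← hsl a, ← hsl b]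
  exact hl _ (hs a) _ (hs b) (hc _ (hs a) _ (hs b) (congrArg Fin.val hcab))

end Neighbors

namespace CliqueExpr

variable {V : Type*} {K : ℕ}

/-- Joins the label `i` to each of the labels in a list. -/
def joinAll (i : Fin K) (e : CliqueExpr V K) : List (Fin K) → CliqueExpr V K
  | [] => e
  | j :: s => join i j (joinAll i e s)

section JoinAll

variable {i : Fin K} {e : CliqueExpr V K} {s : List (Fin K)} {u w : V}

theorem hasLabel_joinAll {a : Fin K} : (joinAll i e s).HasLabel u a ↔ e.HasLabel u a := by
  induction s with
  | nil => rfl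
  | cons _ _ ih => exact ih

theorem WellFormed.joinAll (he : e.WellFormed) (hi : i ∉ s) : (joinAll i e s).WellFormed := by
  induction s with
  | nil => exact he
  | cons _ _ ih => exact ⟨List.ne_of_not_mem_cons hi, ih (List.not_mem_of_not_mem_cons hi)⟩

theorem IsLinear.joinAll (he : e.IsLinear) : (joinAll i e s).IsLinear := by
  induction s with
  | nil => exact he
  | cons _ _ ih => exact ih

theorem joinAll_adj_iff : (joinAll i e s).graph.Adj u w ↔ e.graph.Adj u w ∨ (u ≠ w ∧ ∃ b ∈ s,
    (e.HasLabel u i ∧ e.HasLabel w b) ∨ (e.HasLabel w i ∧ e.HasLabel u b)) := by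
  induction s with
  | nil => simp [joinAll]
  | cons j s ih =>
    simp only [joinAll, graph, SimpleGraph.sup_adj, SimpleGraph.fromRel_adj, ih, hasLabel_joinAll,
      List.mem_cons, exists_eq_or_imp]
    rw [or_assoc, ← and_or_left, or_comm (a := ∃ b ∈ s, _)]

end JoinAll

/-- The linear expression `e` defines the subgraph of `G` induced by `P`, with labels `l`. -/
structure Builds (G : SimpleGraph V) (P : Set V) (l : V → Fin K) (e : CliqueExpr V K) : Prop where
  wellFormed : e.WellFormed
  isLinear : e.IsLinear
  hasLabel_iff : ∀ u a, e.HasLabel u a ↔ u ∈ P ∧ l u = a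
  adj_iff : ∀ u w, e.graph.Adj u w ↔ u ∈ P ∧ w ∈ P ∧ G.Adj u w

variable {G : SimpleGraph V} {P F : Set V} {l : V → Fin K} {e : CliqueExpr V K} {z : V}

theorem builds_vertex (G : SimpleGraph V) (z : V) (i : Fin K) :
    Builds G {z} (fun _ => i) (vertex i z) where
  wellFormed := trivial
  isLinear := trivial
  hasLabel_iff u a := by simp [HasLabel, eq_comm]
  adj_iff u w := by
    simp only [graph, SimpleGraph.bot_adj, Set.mem_singleton_iff, false_iff]
    rintro ⟨rfl, rfl, h⟩
    exact h.ne rfl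

namespace Builds

theorem mem_verts_iff (h : Builds G P l e) {u : V} : u ∈ e.verts ↔ u ∈ P := by
  simp [mem_verts_iff_exists_hasLabel, h.hasLabel_iff]

theorem congr (h : Builds G P l e) {l' : V → Fin K} (hl : ∀ u ∈ P, l u = l' u) :
    Builds G P l' e where
  wellFormed := h.wellFormed
  isLinear := h.isLinear
  hasLabel_iff u a := (h.hasLabel_iff u a).trans (and_congr_right fun hu => by rw [hl u hu])
  adj_iff := h.adj_iff

open Classical in
theorem relabel (h : Builds G P l e) (i j : Fin K) :
    Builds G P (fun v => if l v = i then j else l v) (relabel i j e) where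
  wellFormed := h.wellFormed
  isLinear := h.isLinear
  hasLabel_iff u a := by
    simp only [HasLabel, h.hasLabel_iff]
    split_ifs <;> grind
  adj_iff := h.adj_iff

open Classical in
theorem exists_comp_of_idempotent (h : Builds G P l e) {f : Fin K → Fin K}
    (hf : ∀ a, f (f a) = f a) : ∃ e' : CliqueExpr V K, Builds G P (f ∘ l) e' := by
  have relabel_subset (s : Finset (Fin K)) :
      ∃ e' : CliqueExpr V K, Builds G P (fun v => if l v ∈ s then f (l v) else l v) e' := by
    induction s using Finset.induction_on with
    | empty => exact ⟨e, by simpa using h⟩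
    | insert i s _ ih =>
      obtain ⟨e', he'⟩ := ih
      by_cases hi : f i = i
      · exact ⟨e', he'.congr fun u _ => by grind⟩
      · exact ⟨_, (he'.relabel i (f i)).congr fun u _ => by grind⟩
  obtain ⟨e', he'⟩ := relabel_subset Finset.univ
  exact ⟨e', he'.congr fun u _ => by simp⟩

theorem exists_canonical (h : Builds G P l e) (hl : Uniform G P F l) :
    ∃ (l' : V → Fin K) (e' : CliqueExpr V K), Builds G P l' e' ∧
      ∀ u ∈ P, ∀ w ∈ P, (l' u = l' w ↔ neighborsIn G F u = neighborsIn G F w) := by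
  have hfac : (P.domRestrict (neighborsIn G F)).FactorsThrough (P.domRestrict l) :=
    fun u w huw => hl u u.2 w w.2 huw
  let g : Fin K → Set V := Function.extend (P.domRestrict l) (P.domRestrict (neighborsIn G F)) ⊥
  have hg {v} (hv : v ∈ P) : g (l v) = neighborsIn G F v := hfac.extend_apply _ ⟨v, hv⟩
  obtain ⟨f, hff, hfg⟩ := exists_idempotent_apply_eq_iff g
  obtain ⟨e', he'⟩ := h.exists_comp_of_idempotent hff
  refine ⟨f ∘ l, e', he', fun u hu w hw => ?_⟩
  rw [Function.comp_apply, Function.comp_apply, hfg, hg hu, hg hw]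

open Classical in
theorem hasLabel_union_vertex (h : Builds G P l e) (hz : z ∉ P) (i : Fin K) (u : V) (a : Fin K) :
    (union (vertex i z) e).HasLabel u a ↔ u ∈ insert z P ∧ Function.update l z i u = a := by
  change (u = z ∧ a = i) ∨ e.HasLabel u a ↔ _
  rw [h.hasLabel_iff]
  by_cases hu : u = z
  · subst hu
    simp [hz, eq_comm]
  · simp [hu]

open Classical in
/-- All vertices with the label of a neighbour of `z` are adjacent to all vertices with the label
`i` of `z`, so the joins between these labels create no edges outside `G`. -/
theorem adj_of_update_eq (hl : Uniform G P {z} l) {i : Fin K}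
    (hi : ∀ u ∈ P, l u = i → neighborsIn G P z ⊆ neighborsIn G P u) {u w : V}
    (hu : u ∈ insert z P) (hui : Function.update l z i u = i) (hw : w ∈ insert z P)
    (hwl : Function.update l z i w ∈ l '' neighborsIn G P z) : G.Adj u w := by
  obtain ⟨v, hv, hvw⟩ := hwl
  have hwz : w ≠ z := by
    rintro rfl
    rw [Function.update_self] at hvw
    exact (hi v hv.2 hvw hv).1.ne rfl
  have hwP : w ∈ P := hw.resolve_left hwz
  rw [Function.update_of_ne hwz] at hvw
  have hzw : G.Adj z w :=
    ((neighborsIn_eq_iff.1 (hl v hv.2 w hwP hvw) z rfl).1 hv.1.symm).symm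
  by_cases huz : u = z
  · exact huz ▸ hzw
  · rw [Function.update_of_ne huz] at hui
    exact (hi u (hu.resolve_left huz) hui ⟨hzw, hwP⟩).1

open Classical in
theorem exists_insert (h : Builds G P l e) (hz : z ∉ P) (hl : Uniform G P {z} l) {i : Fin K}
    (hi : ∀ u ∈ P, l u = i → neighborsIn G P z ⊆ neighborsIn G P u) :
    ∃ e' : CliqueExpr V K, Builds G (insert z P) (Function.update l z i) e' := by
  have hlab := h.hasLabel_union_vertex hz i
  have hold {u} (hu : u ∈ P) : Function.update l z i u = l u :=
    Function.update_of_ne (ne_of_mem_of_not_mem hu hz) ..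
  let s : List (Fin K) := (Set.toFinite (l '' neighborsIn G P z)).toFinset.toList
  have hs {b} : b ∈ s ↔ b ∈ l '' neighborsIn G P z := by simp [s]
  refine ⟨joinAll i (union (vertex i z) e) s, ?_, ?_, fun u a => hasLabel_joinAll.trans (hlab u a),
    fun u w => ?_⟩
  · refine .joinAll ⟨trivial, h.wellFormed, ?_⟩ fun his => ?_
    · exact Set.disjoint_singleton_left.2 (h.mem_verts_iff.not.2 hz)
    · obtain ⟨v, hv, hvi⟩ := hs.1 his
      exact (hi v hv.2 hvi hv).1.ne rfl
  · exact .joinAll ⟨trivial, h.isLinear, Or.inl ⟨i, z, rfl⟩⟩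
  · have hunion : (union (vertex i z) e).graph.Adj u w ↔ u ∈ P ∧ w ∈ P ∧ G.Adj u w := by
      simp [graph, h.adj_iff]
    simp only [joinAll_adj_iff, hunion, hlab]
    constructor
    · rintro (⟨hu, hw, huw⟩ | ⟨-, b, hb, ⟨⟨hu, hui⟩, hw, rfl⟩ | ⟨⟨hw, hwi⟩, hu, rfl⟩⟩)
      · exact ⟨Or.inr hu, Or.inr hw, huw⟩
      · exact ⟨hu, hw, adj_of_update_eq hl hi hu hui hw (hs.1 hb)⟩
      · exact ⟨hu, hw, (adj_of_update_eq hl hi hw hwi hu (hs.1 hb)).symm⟩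
    · rintro ⟨rfl | hu, rfl | hw, huw⟩
      · exact (huw.ne rfl).elim
      · exact Or.inr ⟨huw.ne, l w, hs.2 ⟨w, ⟨huw, hw⟩, rfl⟩,
          Or.inl ⟨⟨Or.inl rfl, Function.update_self ..⟩, Or.inr hw, hold hw⟩⟩
      · exact Or.inr ⟨huw.ne, l u, hs.2 ⟨u, ⟨huw.symm, hu⟩, rfl⟩,
          Or.inr ⟨⟨Or.inl rfl, Function.update_self ..⟩, Or.inr hu, hold hu⟩⟩
      · exact Or.inl ⟨hu, hw, huw⟩

open Classical in
theorem exists_of_canAdd {k : ℕ} {l : V → Fin (k + 1)} {e : CliqueExpr V (k + 1)}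
    (h : Builds G P l e) (hz : z ∉ P) (hl : Uniform G P (insert z F) l) (hc : CanAdd G k P z F) :
    ∃ (l' : V → Fin (k + 1)) (e' : CliqueExpr V (k + 1)), Builds G (insert z P) l' e' ∧
      Uniform G (insert z P) F l' := by
  obtain ⟨l', e', he', hl'⟩ := h.exists_canonical hl
  have huni : Uniform G P (insert z F) l' := fun u hu w hw => (hl' u hu w hw).1
  suffices ∃ i, (∀ u ∈ P, l' u = i → neighborsIn G P z ⊆ neighborsIn G P u) ∧
      ∀ u ∈ P, l' u = i → neighborsIn G F u = neighborsIn G F z by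
    obtain ⟨i, hi, hiF⟩ := this
    obtain ⟨e'', he''⟩ := he'.exists_insert hz (huni.mono (by simp)) hi
    exact ⟨_, e'', he'', (huni.mono (Set.subset_insert _ _)).update hz hiF⟩
  rcases hc with ⟨c, hck, hcu⟩ | ⟨v, hv, hvz, hshare⟩
  · obtain ⟨i, hi⟩ := exists_forall_ne_of_uniform (fun u hu w hw => (hl' u hu w hw).2) hcu hck
    exact ⟨i, fun u hu hui => (hi u hu hui).elim, fun u hu hui => (hi u hu hui).elim⟩
  · refine ⟨l' v, fun u hu huv => hshare u hu (huni u hu v hv huv), fun u hu huv => ?_⟩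
    exact (neighborsIn_eq_of_subset (Set.subset_insert _ _) (huni u hu v hv huv)).trans hvz

theorem linearCliqueWidth_induce_le (h : Builds G P l e) {S : Set V} (hS : S ⊆ P) :
    linearCliqueWidth (G.induce S) ≤ K := by
  refine sInf_le ⟨K, rfl, ?_⟩
  rcases disjoint_verts_or_exists_isRestriction S e with hd | ⟨e', he'⟩
  · exact Or.inl ⟨fun u => Set.disjoint_left.1 hd (h.mem_verts_iff.2 (hS u.2)) u.2⟩
  · refine Or.inr ⟨e', he'.isLinear h.isLinear, he'.wellFormed h.wellFormed, ?_, ?_⟩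
    · exact Set.eq_univ_of_forall fun u =>
        (he'.mem_verts_iff u).2 (h.mem_verts_iff.2 (hS u.2))
    · ext u w
      simp [he'.adj_iff, h.adj_iff, hS u.2, hS w.2]

end Builds

theorem exists_builds_of_canAdd {k : ℕ} {ι : Type*} [LinearOrder ι] (G : SimpleGraph V)
    (t : V → ι) (s : Finset V) (F : Set V) (ht : Set.InjOn t s) (hs : s.Nonempty)
    (hadd : ∀ z ∈ s, CanAdd G k {u | u ∈ s ∧ t u < t z} z ({u | u ∈ s ∧ t z < t u} ∪ F)) :
    ∃ (l : V → Fin (k + 1)) (e : CliqueExpr V (k + 1)), Builds G s l e ∧ Uniform G s F l := by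
  classical
  induction s using Finset.induction_on_max_value t generalizing F with
  | empty => exact (Finset.not_nonempty_empty hs).elim
  | insert z s hz hmax ih =>
    rcases s.eq_empty_or_nonempty with rfl | hne
    · refine ⟨fun _ => 0, vertex 0 z, by simpa using builds_vertex G z 0, ?_⟩
      simp only [insert_empty_eq, Finset.coe_singleton]
      rintro u rfl w rfl -
      rfl
    have hlt : ∀ u ∈ s, t u < t z := fun u hu => (hmax u hu).lt_of_ne fun htu =>
      hz (ht (by simp [hu]) (by simp) htu ▸ hu)
    obtain ⟨l, e, he, hl⟩ := ih (insert z F) (ht.mono (by simp)) hne fun u hu => by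
      convert hadd u (Finset.mem_insert_of_mem hu) using 1 <;> ext y <;> clear ih hadd <;> grind
    rw [Finset.coe_insert]
    refine he.exists_of_canAdd hz hl ?_
    convert hadd z (Finset.mem_insert_self z s) using 1 <;> ext y <;> clear ih hadd <;> grind

theorem exists_builds_of_layout {k : ℕ} (G : SimpleGraph V) {Q : Set V} (hQ : Q.Finite)
    (hne : Q.Nonempty) {ι : Type*} [LinearOrder ι] {t : V → ι} (ht : Set.InjOn t Q)
    (hadd : ∀ z ∈ Q, CanAdd G k {u | u ∈ Q ∧ t u < t z} z {u | u ∈ Q ∧ t z < t u}) :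
    ∃ (l : V → Fin (k + 1)) (e : CliqueExpr V (k + 1)), Builds G Q l e := by
  lift Q to Finset V using hQ
  obtain ⟨l, e, he, -⟩ := exists_builds_of_canAdd G t Q ∅ ht hne (by simpa using hadd)
  exact ⟨l, e, he⟩

end CliqueExpr

/-! ### Layouts of path powers with a deleted vertex -/

theorem canAdd_of_adj_imp {V ι : Type*} [LinearOrder ι] {G : SimpleGraph V} {k : ℕ} {Q : Set V}
    {t : V → ι} {z : V} (hz : z ∈ Q) (c : V → ℕ) (hc : ∀ u ∈ Q, t u < t z → c u < k)
    (hadj : ∀ u ∈ Q, t u < t z → ∀ w ∈ Q, t w < t z → c u = c w →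
      ∀ y ∈ Q, t z ≤ t y → G.Adj u y → G.Adj w y) :
    CanAdd G k {u | u ∈ Q ∧ t u < t z} z {u | u ∈ Q ∧ t z < t u} := by
  refine .inl ⟨c, fun u hu => hc u hu.1 hu.2, uniform_of_adj_imp fun u hu w hw hcuw y hy => ?_⟩
  have hyQ : y ∈ Q ∧ t z ≤ t y := by
    rcases hy with rfl | hy
    · exact ⟨hz, le_rfl⟩
    · exact ⟨hy.1, hy.2.le⟩
  exact hadj u hu.1 hu.2 w hw.1 hw.2 hcuw y hyQ.1 hyQ.2

/-- Row `r` of column `c`, where `k` columns are numbered from `0` and their `k + 1` rows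
from `1`. -/
def InGrid (k c r : ℕ) : Prop :=
  c < k ∧ 1 ≤ r ∧ r ≤ k + 1

/-- Adjacency of the vertices in row `r` of column `c` and in row `r'` of column `c'`, for columns
of `k + 1` consecutive vertices. -/
def ColAdj (c r c' r' : ℕ) : Prop :=
  (c = c' ∧ r ≠ r') ∨ (c' = c + 1 ∧ r' < r) ∨ (c = c' + 1 ∧ r < r')

/-- The time at which the vertex in row `r` of column `c` on the right (`b = true`) or left
(`b = false`) of the deleted vertex is added: first the right side is added, diagonal by diagonal
towards the deleted vertex, then the left side, diagonal by diagonal away from it. The second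
component orders the vertices of a diagonal `c + r`; its direction changes when the diagonal no
longer meets all columns. -/
def gridTime (k : ℕ) (b : Bool) (c r : ℕ) : ℕ ×ₗ ℕ :=
  toLex (if b then 2 * k + 2 - (c + r) else 2 * k + 3 + (c + r),
    if (if b then k ≤ c + r else c + r < k) then c else k - c)

/-- A label for the right vertex in row `r` of column `c` at the time when the right vertex in
row `q` of column `m` is added: in general its column, but as soon as the columns from `m + q` on
have no neighbours to come, their labels distinguish the vertices of column `0`, which differ in
their neighbours on the left. -/
def rightLabel (k m q c r : ℕ) : ℕ :=
  if k ≤ m + q then c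
  else if c = m + 1 ∧ r + m + 1 = m + q then m + q
  else if c = 0 ∧ r + 1 ≤ k then r
  else if c + 2 ≤ m + q then c
  else if c + 1 = m + q ∧ c = m then m + q
  else m + q - 1

/-- A label for the vertex in row `r` of column `c` on side `b` at the time when the left vertex in
row `q` of column `m` is added: a left vertex is labelled by its column, while the right vertices
share the columns not yet in use, which suffice for their different neighbours to come. -/
def leftLabel (k m q : ℕ) (b : Bool) (c r : ℕ) : ℕ :=
  if m + q < k then
    if b then
      if c = 0 ∧ r + 1 + (if m = 0 then m + q - 1 else m + q) ≤ k then k - r else m + q - 1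
    else if c + 1 = m ∧ r + m = m + q + 1 then m + q else c
  else if b then k - 1 else c

section Grid

variable {k c r c' r' d s m q : ℕ}

theorem gridTime_right_lt_right_iff (hmq : InGrid k m q) (hcr : InGrid k c r) :
    gridTime k true c r < gridTime k true m q ↔
      m + q < c + r ∨ (m + q = c + r ∧ ((k ≤ m + q ∧ c < m) ∨ (m + q < k ∧ m < c))) := by
  unfold InGrid at hmq hcr
  simp only [gridTime, Prod.Lex.toLex_lt_toLex, if_true]
  split_ifs <;> omega

theorem gridTime_left_lt_left_iff (hm : m < k) (hc : c < k) :
    gridTime k false c r < gridTime k false m q ↔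
      c + r < m + q ∨ (m + q = c + r ∧ ((k ≤ m + q ∧ m < c) ∨ (m + q < k ∧ c < m))) := by
  simp only [gridTime, Prod.Lex.toLex_lt_toLex, Bool.false_eq_true, if_false]
  split_ifs <;> omega

theorem gridTime_right_lt_left : gridTime k true c r < gridTime k false m q := by
  simp only [gridTime, Prod.Lex.toLex_lt_toLex, Bool.false_eq_true, if_true, if_false]
  omega

theorem eq_of_gridTime_eq {b b' : Bool} (hcr : InGrid k c r) (hcr' : InGrid k c' r')
    (h : gridTime k b c r = gridTime k b' c' r') : b = b' ∧ c = c' ∧ r = r' := by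
  unfold InGrid at hcr hcr'
  simp only [gridTime, EmbeddingLike.apply_eq_iff_eq, Prod.mk.injEq] at h
  obtain ⟨hdiag, hpos⟩ := h
  cases b <;> cases b' <;>
    simp only [Bool.false_eq_true, Bool.true_eq_false, if_true, if_false, true_and, false_and]
      at hdiag hpos ⊢ <;>
    split_ifs at hpos <;> omega

theorem rightLabel_lt (hq : 1 ≤ q ∧ q ≤ k + 1) (hc : c < k) : rightLabel k m q c r < k := by
  unfold rightLabel
  split_ifs <;> omega

set_option maxHeartbeats 1000000 in
-- The last step calls `lia` once for each pair of label cases and each position of `(d, s)`.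
theorem colAdj_of_rightLabel_eq (hmq : InGrid k m q) (hcr : InGrid k c r) (hcr' : InGrid k c' r')
    (hds : InGrid k d s) (hlt : gridTime k true c r < gridTime k true m q)
    (hlt' : gridTime k true c' r' < gridTime k true m q)
    (hle : gridTime k true m q ≤ gridTime k true d s)
    (hlabel : rightLabel k m q c r = rightLabel k m q c' r')
    (hadj : ColAdj c r d s) : ColAdj c' r' d s := by
  rw [gridTime_right_lt_right_iff hmq hcr] at hlt
  rw [gridTime_right_lt_right_iff hmq hcr'] at hlt'
  rw [← not_lt, gridTime_right_lt_right_iff hmq hds] at hle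
  unfold InGrid at *
  unfold rightLabel at hlabel
  unfold ColAdj at *
  by_cases hdiag : k ≤ m + q
  · simp only [hdiag, if_true] at hlabel
    subst hlabel
    have hrow : (c < m ∧ m + q ≤ c + r) ∨ (m ≤ c ∧ m + q < c + r) := by omega
    have hrow' : (c < m ∧ m + q ≤ c + r') ∨ (m ≤ c ∧ m + q < c + r') := by omega
    have hrowd : (d < m ∧ d + s < m + q) ∨ (m ≤ d ∧ d + s ≤ m + q) := by omega
    clear hlt hlt' hle
    omega
  · simp only [hdiag, if_false] at hlabel
    have hrow : (m < c ∧ m + q ≤ c + r) ∨ (c ≤ m ∧ m + q < c + r) := by omega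
    have hrow' : (m < c' ∧ m + q ≤ c' + r') ∨ (c' ≤ m ∧ m + q < c' + r') := by omega
    have hrowd : (m < d ∧ d + s < m + q) ∨ (d ≤ m ∧ d + s ≤ m + q) := by omega
    clear hlt hlt' hle
    rcases hadj with ⟨rfl, hadj⟩ | ⟨rfl, hadj⟩ | ⟨rfl, hadj⟩ <;> rcases hrowd with hrowd | hrowd <;>
      rcases hrow' with hrow' | hrow' <;> split_ifs at hlabel <;> lia

theorem eq_of_rightLabel_eq (hmq : InGrid k m q) (hcr : InGrid k 0 r) (hcr' : InGrid k c' r')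
    (hlt : gridTime k true 0 r < gridTime k true m q)
    (hlt' : gridTime k true c' r' < gridTime k true m q)
    (hlabel : rightLabel k m q 0 r = rightLabel k m q c' r') (hr : r + 1 ≤ k) :
    c' = 0 ∧ r' = r := by
  rw [gridTime_right_lt_right_iff hmq hcr] at hlt
  rw [gridTime_right_lt_right_iff hmq hcr'] at hlt'
  unfold InGrid at *
  unfold rightLabel at hlabel
  split_ifs at hlabel <;> omega

theorem leftLabel_lt {b : Bool} (hq : 1 ≤ q) (hc : c < k) (hr : 1 ≤ r) :
    leftLabel k m q b c r < k := by
  unfold leftLabel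
  split_ifs <;> omega

theorem colAdj_of_leftLabel_eq (hmq : InGrid k m q) (hcr : InGrid k c r) (hcr' : InGrid k c' r')
    (hd : d < k) (hlt : gridTime k false c r < gridTime k false m q)
    (hlt' : gridTime k false c' r' < gridTime k false m q)
    (hle : gridTime k false m q ≤ gridTime k false d s)
    (hlabel : leftLabel k m q false c r = leftLabel k m q false c' r')
    (hadj : ColAdj c r d s) : ColAdj c' r' d s := by
  rw [gridTime_left_lt_left_iff hmq.1 hcr.1] at hlt
  rw [gridTime_left_lt_left_iff hmq.1 hcr'.1] at hlt'
  rw [← not_lt, gridTime_left_lt_left_iff hmq.1 hd] at hle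
  unfold InGrid at *
  unfold leftLabel at hlabel
  simp only [if_false, Bool.false_eq_true] at hlabel
  unfold ColAdj at *
  by_cases hdiag : m + q < k
  · simp only [hdiag, if_true] at hlabel
    have hrow : (c < m ∧ c + r ≤ m + q) ∨ (m ≤ c ∧ c + r < m + q) := by omega
    have hrow' : (c' < m ∧ c' + r' ≤ m + q) ∨ (m ≤ c' ∧ c' + r' < m + q) := by omega
    have hrowd : (d < m ∧ m + q < d + s) ∨ (m ≤ d ∧ m + q ≤ d + s) := by omega
    clear hlt hlt' hle
    split_ifs at hlabel <;> omega
  · simp only [hdiag, if_false] at hlabel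
    have hrow : (m < c ∧ c + r ≤ m + q) ∨ (c ≤ m ∧ c + r < m + q) := by omega
    have hrow' : (m < c' ∧ c' + r' ≤ m + q) ∨ (c' ≤ m ∧ c' + r' < m + q) := by omega
    have hrowd : (m < d ∧ m + q < d + s) ∨ (d ≤ m ∧ m + q ≤ d + s) := by omega
    clear hlt hlt' hle
    omega

theorem cross_of_leftLabel_eq (hmq : InGrid k m q) (hr : 1 ≤ r) (hd : d < k)
    (hle : gridTime k false m q ≤ gridTime k false d s)
    (hlabel : leftLabel k m q true c r = leftLabel k m q true c' r')
    (hcross : c = 0 ∧ d = 0 ∧ r + s ≤ k) : c' = 0 ∧ d = 0 ∧ r' + s ≤ k := by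
  rw [← not_lt, gridTime_left_lt_left_iff hmq.1 hd] at hle
  unfold InGrid at hmq
  unfold leftLabel at hlabel
  simp only [if_true] at hlabel
  split_ifs at hlabel <;> omega

theorem leftLabel_right_ne_left (hmq : InGrid k m q) (hc' : c' + 2 ≤ k) (hr' : 1 ≤ r')
    (hlt' : gridTime k false c' r' < gridTime k false m q) :
    leftLabel k m q true c r ≠ leftLabel k m q false c' r' := by
  rw [gridTime_left_lt_left_iff hmq.1 (by omega)] at hlt'
  unfold InGrid at hmq
  unfold leftLabel
  simp only [if_true, if_false, Bool.false_eq_true]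
  split_ifs <;> omega

end Grid

/-- The vertices of `Q` form at most `k` columns of consecutive vertices on either side of a deleted
vertex: the vertex `u` lies in row `r u` of column `c u` on the right if `R u = true` and on the
left if `R u = false`. Rows and columns are counted from the deleted vertex, and the last left
column, if it is used at all, consists of the only left vertex. -/
structure IsColumnLayout {V : Type*} (G : SimpleGraph V) (k : ℕ) (Q : Set V) (R : V → Bool)
    (c r : V → ℕ) : Prop where
  inGrid : ∀ u ∈ Q, InGrid k (c u) (r u)
  inj : ∀ u ∈ Q, ∀ w ∈ Q, R u = R w → c u = c w → r u = r w → u = w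
  left : ∀ u ∈ Q, ∀ w ∈ Q, R u = false → R w = false → u ≠ w → c u + 2 ≤ k
  adj_same : ∀ u ∈ Q, ∀ w ∈ Q, R u = R w → (G.Adj u w ↔ ColAdj (c u) (r u) (c w) (r w))
  adj_cross : ∀ u ∈ Q, ∀ w ∈ Q, R u = true → R w = false →
    (G.Adj u w ↔ c u = 0 ∧ c w = 0 ∧ r u + r w ≤ k)

namespace IsColumnLayout

variable {V : Type*} {G : SimpleGraph V} {k : ℕ} {Q : Set V} {R : V → Bool} {c r : V → ℕ} {z : V}

theorem canAdd_left (h : IsColumnLayout G k Q R c r) (hz : z ∈ Q) (hRz : R z = false) :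
    CanAdd G k
      {u | u ∈ Q ∧ gridTime k (R u) (c u) (r u) < gridTime k (R z) (c z) (r z)} z
      {u | u ∈ Q ∧ gridTime k (R z) (c z) (r z) < gridTime k (R u) (c u) (r u)} := by
  refine canAdd_of_adj_imp (t := fun u => gridTime k (R u) (c u) (r u)) hz
    (fun u => leftLabel k (c z) (r z) (R u) (c u) (r u))
    (fun u hu _ => leftLabel_lt (h.inGrid z hz).2.1 (h.inGrid u hu).1 (h.inGrid u hu).2.1) ?_
  intro u hu hut w hw hwt hlabel y hy hyt hadj
  simp only [hRz] at hut hwt hyt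
  have hRy : R y = false := Bool.eq_false_iff.2 fun hRy =>
    hyt.not_gt (hRy ▸ gridTime_right_lt_left)
  have hright_ne_left : ∀ v, ∀ v' ∈ Q, R v = true → R v' = false →
      gridTime k (R v') (c v') (r v') < gridTime k false (c z) (r z) →
      leftLabel k (c z) (r z) (R v) (c v) (r v) ≠
        leftLabel k (c z) (r z) (R v') (c v') (r v') := by
    intro v v' hv' hRv hRv' hlt
    have hne : v' ≠ z := by
      rintro rfl
      exact hlt.ne (by rw [hRv'])
    rw [hRv'] at hlt
    rw [hRv, hRv']
    exact leftLabel_right_ne_left (h.inGrid z hz) (h.left v' hv' z hz hRv' hRz hne)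
      (h.inGrid v' hv').2.1 hlt
  rw [hRy] at hyt
  cases hRu : R u <;> cases hRw : R w
  · rw [hRu] at hut hlabel
    rw [hRw] at hwt hlabel
    rw [h.adj_same u hu y hy (hRu.trans hRy.symm)] at hadj
    rw [h.adj_same w hw y hy (hRw.trans hRy.symm)]
    exact colAdj_of_leftLabel_eq (h.inGrid z hz) (h.inGrid u hu) (h.inGrid w hw)
      (h.inGrid y hy).1 hut hwt hyt hlabel hadj
  · exact (hright_ne_left w u hu hRw hRu hut hlabel.symm).elim
  · exact (hright_ne_left u w hw hRu hRw hwt hlabel).elim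
  · rw [hRu, hRw] at hlabel
    rw [h.adj_cross u hu y hy hRu hRy] at hadj
    rw [h.adj_cross w hw y hy hRw hRy]
    exact cross_of_leftLabel_eq (h.inGrid z hz) (h.inGrid u hu).2.1 (h.inGrid y hy).1 hyt
      hlabel hadj

theorem canAdd_right (h : IsColumnLayout G k Q R c r) (hz : z ∈ Q) (hRz : R z = true) :
    CanAdd G k
      {u | u ∈ Q ∧ gridTime k (R u) (c u) (r u) < gridTime k (R z) (c z) (r z)} z
      {u | u ∈ Q ∧ gridTime k (R z) (c z) (r z) < gridTime k (R u) (c u) (r u)} := by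
  refine canAdd_of_adj_imp (t := fun u => gridTime k (R u) (c u) (r u)) hz
    (fun u => rightLabel k (c z) (r z) (c u) (r u))
    (fun u hu _ => rightLabel_lt (h.inGrid z hz).2 (h.inGrid u hu).1) ?_
  intro u hu hut w hw hwt hlabel y hy hyt hadj
  simp only [hRz] at hut hwt hyt
  have hright : ∀ {v : V}, gridTime k (R v) (c v) (r v) < gridTime k true (c z) (r z) →
      R v = true := fun {v} hlt => by
    by_contra hRv
    rw [Bool.not_eq_true] at hRv
    exact hlt.not_gt (hRv ▸ gridTime_right_lt_left)
  have hRu := hright hut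
  have hRw := hright hwt
  rw [hRu] at hut
  rw [hRw] at hwt
  cases hRy : R y
  · rw [h.adj_cross u hu y hy hRu hRy] at hadj
    rw [h.adj_cross w hw y hy hRw hRy]
    obtain ⟨hcu, hcy, hrow⟩ := hadj
    have hu_grid := h.inGrid u hu
    have hry := (h.inGrid y hy).2.1
    rw [hcu] at hut hlabel hu_grid
    obtain ⟨hcw, hrw⟩ := eq_of_rightLabel_eq (h.inGrid z hz) hu_grid (h.inGrid w hw) hut hwt
      hlabel (by omega)
    exact ⟨hcw, hcy, hrw ▸ hrow⟩
  · rw [hRy] at hyt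
    rw [h.adj_same u hu y hy (hRu.trans hRy.symm)] at hadj
    rw [h.adj_same w hw y hy (hRw.trans hRy.symm)]
    exact colAdj_of_rightLabel_eq (h.inGrid z hz) (h.inGrid u hu) (h.inGrid w hw) (h.inGrid y hy)
      hut hwt hyt hlabel hadj

open CliqueExpr in
theorem exists_builds (h : IsColumnLayout G k Q R c r) (hQ : Q.Finite) (hne : Q.Nonempty) :
    ∃ (l : V → Fin (k + 1)) (e : CliqueExpr V (k + 1)), Builds G Q l e := by
  refine exists_builds_of_layout G hQ hne (t := fun u => gridTime k (R u) (c u) (r u)) ?_ ?_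
  · intro u hu w hw htime
    obtain ⟨hR, hc, hr⟩ := eq_of_gridTime_eq (h.inGrid u hu) (h.inGrid w hw) htime
    exact h.inj u hu w hw hR hc hr
  · intro z hz
    cases hRz : R z
    · simpa only [hRz] using h.canAdd_left hz hRz
    · simpa only [hRz] using h.canAdd_right hz hRz

end IsColumnLayout

/-- The vertices of `Q` other than `z` form columns of `k + 1` consecutive vertices, where `u` lies
in row `r u` of column `c u`, and `z` comes immediately before the first column. -/
structure IsApexLayout {V : Type*} (G : SimpleGraph V) (k : ℕ) (Q : Set V) (z : V)
    (c r : V → ℕ) : Prop where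
  apex_mem : z ∈ Q
  inGrid : ∀ u ∈ Q, u ≠ z → InGrid k (c u) (r u)
  inj : ∀ u ∈ Q, ∀ w ∈ Q, u ≠ z → w ≠ z → c u = c w → r u = r w → u = w
  adj : ∀ u ∈ Q, ∀ w ∈ Q, u ≠ z → w ≠ z → (G.Adj u w ↔ ColAdj (c u) (r u) (c w) (r w))
  adj_apex : ∀ u ∈ Q, u ≠ z → (G.Adj u z ↔ c u = 0 ∧ r u ≤ k)
  last_row : ∀ u ∈ Q, u ≠ z → ∀ d ≤ c u, ∃ w ∈ Q, w ≠ z ∧ c w = d ∧ r w = k + 1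

open Classical in
/-- The time at which a vertex is added: the grid row by row, with `z` between the first and the
second vertex of the last row. -/
noncomputable def apexTime {V : Type*} (k : ℕ) (z : V) (c r : V → ℕ) (u : V) : ℕ ×ₗ ℕ :=
  if u = z then toLex (k + 1, 1) else toLex (r u, 2 * c u)

namespace IsApexLayout

variable {V : Type*} {G : SimpleGraph V} {k : ℕ} {Q : Set V} {z u w : V} {c r : V → ℕ}

theorem apexTime_lt_iff (hu : u ≠ z) (hw : w ≠ z) :
    apexTime k z c r u < apexTime k z c r w ↔ r u < r w ∨ (r u = r w ∧ c u < c w) := by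
  simp only [apexTime, hu, hw, if_false, Prod.Lex.toLex_lt_toLex]
  omega

theorem apexTime_lt_apex_iff (h : IsApexLayout G k Q z c r) (hu : u ∈ Q) (huz : u ≠ z) :
    apexTime k z c r u < apexTime k z c r z ↔ r u ≤ k ∨ c u = 0 := by
  have hgrid := h.inGrid u hu huz
  unfold InGrid at hgrid
  simp only [apexTime, huz, if_false, if_true, Prod.Lex.toLex_lt_toLex]
  omega

theorem apex_lt_apexTime_iff (h : IsApexLayout G k Q z c r) (hu : u ∈ Q) (huz : u ≠ z) :
    apexTime k z c r z < apexTime k z c r u ↔ r u = k + 1 ∧ 1 ≤ c u := by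
  have hgrid := h.inGrid u hu huz
  unfold InGrid at hgrid
  simp only [apexTime, huz, if_false, if_true, Prod.Lex.toLex_lt_toLex]
  omega

theorem injOn_apexTime (h : IsApexLayout G k Q z c r) : Set.InjOn (apexTime k z c r) Q := by
  intro u hu w hw htime
  by_cases huz : u = z <;> by_cases hwz : w = z
  · rw [huz, hwz]
  · simp only [apexTime, huz, hwz, if_true, if_false, EmbeddingLike.apply_eq_iff_eq,
      Prod.mk.injEq] at htime
    omega
  · simp only [apexTime, huz, hwz, if_true, if_false, EmbeddingLike.apply_eq_iff_eq,
      Prod.mk.injEq] at htime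
    omega
  · simp only [apexTime, huz, hwz, if_false, EmbeddingLike.apply_eq_iff_eq,
      Prod.mk.injEq] at htime
    exact h.inj u hu w hw huz hwz (by omega) htime.1

theorem not_adj_of_apex_lt (h : IsApexLayout G k Q z c r) {y : V} (hy : y ∈ Q)
    (hzy : apexTime k z c r z < apexTime k z c r y) :
    ¬ G.Adj z y ∧ ∀ w ∈ Q, w ≠ z → c w = 0 → r w = k + 1 → ¬ G.Adj w y := by
  have hyz : y ≠ z := fun hyz => hzy.ne (by rw [hyz])
  rw [h.apex_lt_apexTime_iff hy hyz] at hzy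
  rw [G.adj_comm, h.adj_apex y hy hyz]
  refine ⟨by omega, fun w hw hwz hcw hrw => ?_⟩
  rw [h.adj w hw y hy hwz hyz]
  unfold ColAdj
  omega

theorem column_eq_zero_of_not_adj (h : IsApexLayout G k Q z c r) {v : V} (hv : v ∈ Q) (hvz : v ≠ z)
    (hlt : apexTime k z c r v < apexTime k z c r z)
    (hnot : ∀ y ∈ Q, apexTime k z c r z < apexTime k z c r y → ¬ G.Adj v y) : c v = 0 := by
  by_contra hcv
  obtain ⟨y, hy, hyz, hcy, hry⟩ := h.last_row v hv hvz (c v) le_rfl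
  have hzy := (h.apex_lt_apexTime_iff hy hyz).2 ⟨hry, by omega⟩
  refine hnot y hy hzy ?_
  rw [h.apexTime_lt_apex_iff hv hvz] at hlt
  rw [h.adj v hv y hy hvz hyz]
  unfold ColAdj
  omega

/-- The last vertex of the first column lends its label to `z`. -/
theorem canAdd_apex (h : IsApexLayout G k Q z c r) :
    CanAdd G k {u | u ∈ Q ∧ apexTime k z c r u < apexTime k z c r z} z
      {u | u ∈ Q ∧ apexTime k z c r z < apexTime k z c r u} := by
  by_cases hother : ∃ u ∈ Q, u ≠ z
  · obtain ⟨u, hu, huz⟩ := hother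
    obtain ⟨w, hw, hwz, hcw, hrw⟩ := h.last_row u hu huz 0 (Nat.zero_le _)
    have hwz_not : ¬ G.Adj w z := by
      rw [h.adj_apex w hw hwz]
      omega
    refine .inr ⟨w, ⟨hw, (h.apexTime_lt_apex_iff hw hwz).2 (.inr hcw)⟩, ?_, ?_⟩
    · refine neighborsIn_eq_iff.2 fun y hy => ?_
      have hnot := h.not_adj_of_apex_lt hy.1 hy.2
      exact iff_of_false (hnot.2 w hw hwz hcw hrw) hnot.1
    · rintro v ⟨hv, hvt⟩ hvw s hs
      rw [neighborsIn_eq_iff] at hvw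
      have hvz : v ≠ z := fun hvz => hvt.ne (by rw [hvz])
      have hvz_not : ¬ G.Adj v z := by rwa [hvw z (Set.mem_insert _ _)]
      have hcv : c v = 0 := h.column_eq_zero_of_not_adj hv hvz hvt fun y hy hzy => by
        rw [hvw y (Set.mem_insert_of_mem _ ⟨hy, hzy⟩)]
        exact (h.not_adj_of_apex_lt hy hzy).2 w hw hwz hcw hrw
      obtain ⟨hzs, hsP⟩ := mem_neighborsIn.1 hs
      have hsz : s ≠ z := hzs.ne'
      refine mem_neighborsIn.2 ⟨?_, hsP⟩
      rw [G.adj_comm, h.adj_apex s hsP.1 hsz] at hzs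
      rw [h.adj_apex v hv hvz] at hvz_not
      rw [h.adj v hv s hsP.1 hvz hsz]
      unfold ColAdj
      omega
  · push Not at hother
    have hempty : ∀ u ∈ Q, ¬ apexTime k z c r u < apexTime k z c r z := fun u hu hlt =>
      hlt.ne (by rw [hother u hu])
    exact canAdd_of_adj_imp h.apex_mem (fun _ => 0) (fun u hu hlt => (hempty u hu hlt).elim)
      fun u hu hlt => (hempty u hu hlt).elim

open Classical in
theorem canAdd_of_ne (h : IsApexLayout G k Q z c r) {x : V} (hx : x ∈ Q) (hxz : x ≠ z) :
    CanAdd G k {u | u ∈ Q ∧ apexTime k z c r u < apexTime k z c r x} x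
      {u | u ∈ Q ∧ apexTime k z c r x < apexTime k z c r u} := by
  have hgrid : ∀ u ∈ Q, u ≠ z → c u < k ∧ 1 ≤ r u ∧ r u ≤ k + 1 := h.inGrid
  have hgridx := hgrid x hx hxz
  refine canAdd_of_adj_imp hx (fun u => if u = z then 0 else c u) ?_ ?_
  · intro u hu _
    split_ifs with huz
    · omega
    · exact (h.inGrid u hu huz).1
  intro u hu hux w hw hwx hc y hy hxy hadj
  by_cases hyz : y = z
  · subst hyz
    have huy : u ≠ y := hadj.ne
    have hwy : w ≠ y := fun hwy => hxy.not_gt (hwy ▸ hwx)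
    rw [← not_lt, h.apex_lt_apexTime_iff hx hxz] at hxy
    rw [apexTime_lt_iff hwy hxz] at hwx
    simp only [huy, hwy, if_false] at hc
    rw [h.adj_apex u hu huy] at hadj
    rw [h.adj_apex w hw hwy]
    omega
  have hgridy := hgrid y hy hyz
  rw [← not_lt, apexTime_lt_iff hyz hxz] at hxy
  by_cases huz : u = z
  · rw [huz, h.apex_lt_apexTime_iff hx hxz] at hux
    rw [huz, G.adj_comm, h.adj_apex y hy hyz] at hadj
    omega
  have hgridu := hgrid u hu huz
  rw [h.adj u hu y hy huz hyz] at hadj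
  rw [apexTime_lt_iff huz hxz] at hux
  unfold ColAdj at hadj
  by_cases hwz : w = z
  · rw [hwz, h.apex_lt_apexTime_iff hx hxz] at hwx
    simp only [huz, hwz, if_false, if_true] at hc
    omega
  · simp only [huz, hwz, if_false] at hc
    rw [h.adj w hw y hy hwz hyz]
    rw [apexTime_lt_iff hwz hxz] at hwx
    unfold ColAdj
    omega

open CliqueExpr in
theorem exists_builds (h : IsApexLayout G k Q z c r) (hQ : Q.Finite) :
    ∃ (l : V → Fin (k + 1)) (e : CliqueExpr V (k + 1)), Builds G Q l e := by
  refine exists_builds_of_layout G hQ ⟨z, h.apex_mem⟩ h.injOn_apexTime fun x hx => ?_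
  by_cases hxz : x = z
  · exact hxz ▸ h.canAdd_apex
  · exact h.canAdd_of_ne hx hxz

end IsApexLayout

section DivMod

variable {k p q : ℕ}

theorem inGrid_div_mod (hp : p < k * (k + 1)) : InGrid k (p / (k + 1)) (p % (k + 1) + 1) :=
  ⟨(Nat.div_lt_iff_lt_mul k.succ_pos).2 hp, Nat.le_add_left _ _, Nat.mod_lt p k.succ_pos⟩

theorem colAdj_mul_add_of_le {c d r s : ℕ} (hcd : c ≤ d) (hr : r < k + 1) (hs : s < k + 1) :
    ColAdj c (r + 1) d (s + 1) ↔ (k + 1) * c + r ≠ (k + 1) * d + s ∧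
      (k + 1) * c + r ≤ (k + 1) * d + s + k ∧ (k + 1) * d + s ≤ (k + 1) * c + r + k := by
  unfold ColAdj
  obtain ⟨e, rfl⟩ := Nat.exists_eq_add_of_le hcd
  rcases e with _ | _ | e
  · rw [Nat.add_zero]
    omega
  · have : (k + 1) * (c + (0 + 1)) = (k + 1) * c + (k + 1) := by ring
    omega
  · have : (k + 1) * (c + (e + 1 + 1)) = (k + 1) * c + (k + 1) * e + 2 * (k + 1) := by ring
    have := Nat.zero_le ((k + 1) * e)
    omega

theorem colAdj_comm {c d r s : ℕ} : ColAdj c r d s ↔ ColAdj d s c r := by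
  unfold ColAdj
  omega

theorem colAdj_div_mod_iff :
    ColAdj (p / (k + 1)) (p % (k + 1) + 1) (q / (k + 1)) (q % (k + 1) + 1) ↔
      p ≠ q ∧ p ≤ q + k ∧ q ≤ p + k := by
  have hp := Nat.mod_lt p k.succ_pos
  have hq := Nat.mod_lt q k.succ_pos
  rcases le_total (p / (k + 1)) (q / (k + 1)) with hle | hle
  · rw [colAdj_mul_add_of_le hle hp hq, Nat.div_add_mod, Nat.div_add_mod]
  · rw [colAdj_comm, colAdj_mul_add_of_le hle hq hp, Nat.div_add_mod, Nat.div_add_mod]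
    omega

theorem div_mod_cross_iff : (p / (k + 1) = 0 ∧ q / (k + 1) = 0 ∧
    p % (k + 1) + 1 + (q % (k + 1) + 1) ≤ k) ↔ p + q + 2 ≤ k := by
  simp only [Nat.div_eq_zero_iff]
  constructor
  · rintro ⟨hp, hq, hpq⟩
    rw [Nat.mod_eq_of_lt (by omega), Nat.mod_eq_of_lt (by omega)] at hpq
    omega
  · intro hpq
    rw [Nat.mod_eq_of_lt (by omega), Nat.mod_eq_of_lt (by omega)]
    omega

theorem div_mod_apex_iff : (p / (k + 1) = 0 ∧ p % (k + 1) + 1 ≤ k) ↔ p + 1 ≤ k := by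
  simp only [Nat.div_eq_zero_iff]
  constructor
  · rintro ⟨hp, hpk⟩
    rwa [Nat.mod_eq_of_lt (by omega)] at hpk
  · intro hpk
    rw [Nat.mod_eq_of_lt (by omega)]
    omega

end DivMod

/-- The number of integers strictly between `p` and `q`, for `p ≠ q`. -/
def numBetween (p q : ℕ) : ℕ :=
  p - q + (q - p) - 1

/-- `pos` gives the vertices of `G` the positions of a `k`-path layout of `Z_k`. -/
structure IsPathLayout {V : Type*} (G : SimpleGraph V) (k : ℕ) (pos : V → ℕ) : Prop where
  inj : Function.Injective pos
  le : ∀ u, pos u ≤ k * (k + 1) + 1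
  surj : ∀ p ≤ k * (k + 1) + 1, ∃ u, pos u = p
  adj : ∀ u w, G.Adj u w ↔ pos u ≠ pos w ∧ pos u ≤ pos w + k ∧ pos w ≤ pos u + k

namespace IsPathLayout

variable {V : Type*} {G : SimpleGraph V} {k : ℕ} {pos : V → ℕ} {x z : V}

theorem finite (h : IsPathLayout G k pos) : Finite V :=
  Finite.of_injective (fun u => (⟨pos u, Nat.lt_succ_of_le (h.le u)⟩ : Fin (k * (k + 1) + 2)))
    fun u w huw => h.inj (by simpa using huw)

theorem isColumnLayout (h : IsPathLayout G k pos) (hpos : 1 ≤ pos x)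
    (hhalf : 2 * pos x ≤ k * (k + 1) + 1) :
    IsColumnLayout G k {x}ᶜ (fun u => decide (pos x < pos u))
      (fun u => numBetween (pos u) (pos x) / (k + 1))
      (fun u => numBetween (pos u) (pos x) % (k + 1) + 1) := by
  have hne : ∀ u ∈ ({x}ᶜ : Set V), pos u ≠ pos x := fun u hu hp => hu (h.inj hp)
  constructor
  · intro u _
    have hu_le := h.le u
    apply inGrid_div_mod
    unfold numBetween
    omega
  · intro u hu w hw hR hc hr
    have heq := Nat.ext_div_mod hc (Nat.succ_injective hr)
    have hu_ne := hne u hu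
    have hw_ne := hne w hw
    simp only [decide_eq_decide] at hR
    unfold numBetween at heq
    exact h.inj (by omega)
  · intro u hu w hw hRu hRw huw
    simp only [decide_eq_false_iff_not, not_lt] at hRu hRw
    have hu_ne := hne u hu
    have hw_ne := hne w hw
    have huw_ne : pos u ≠ pos w := fun hp => huw (h.inj hp)
    obtain ⟨j, rfl⟩ : ∃ j, k = j + 2 := by
      rcases k with _ | _ | j
      · omega
      · omega
      · exact ⟨j, rfl⟩
    have hlt : numBetween (pos u) (pos x) / (j + 2 + 1) < j + 1 := by
      rw [Nat.div_lt_iff_lt_mul (by omega), numBetween]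
      by_contra hcon
      have hfar : (j + 1) * (j + 2 + 1) + 1 ≤ pos x := by omega
      nlinarith
    omega
  · intro u hu w hw hR
    rw [h.adj, colAdj_div_mod_iff]
    simp only [decide_eq_decide] at hR
    have hu_ne := hne u hu
    have hw_ne := hne w hw
    unfold numBetween
    omega
  · intro u _ w hw hRu hRw
    simp only [decide_eq_false_iff_not, not_lt, decide_eq_true_eq] at hRu hRw
    have hw_ne := hne w hw
    rw [h.adj, div_mod_cross_iff]
    unfold numBetween
    omega

theorem isApexLayout (h : IsPathLayout G k pos) (hx : pos x = 0) (hz : pos z = 1) :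
    IsApexLayout G k {x}ᶜ z (fun u => (pos u - 2) / (k + 1))
      (fun u => (pos u - 2) % (k + 1) + 1) := by
  have htwo_le : ∀ u ∈ ({x}ᶜ : Set V), u ≠ z → 2 ≤ pos u := by
    intro u hu huz
    have hux : pos u ≠ pos x := fun hp => hu (h.inj hp)
    have huz : pos u ≠ pos z := fun hp => huz (h.inj hp)
    omega
  have hgrid : ∀ u ∈ ({x}ᶜ : Set V), u ≠ z →
      InGrid k ((pos u - 2) / (k + 1)) ((pos u - 2) % (k + 1) + 1) := by
    intro u hu huz
    have hu_two := htwo_le u hu huz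
    have hu_le := h.le u
    exact inGrid_div_mod (by omega)
  refine ⟨?_, hgrid, ?_, ?_, ?_, ?_⟩
  · rintro rfl
    omega
  · intro u hu w hw huz hwz hc hr
    have heq := Nat.ext_div_mod hc (Nat.succ_injective hr)
    have hu_two := htwo_le u hu huz
    have hw_two := htwo_le w hw hwz
    exact h.inj (by omega)
  · intro u hu w hw huz hwz
    have hu_two := htwo_le u hu huz
    have hw_two := htwo_le w hw hwz
    rw [h.adj, colAdj_div_mod_iff]
    omega
  · intro u hu huz
    have hu_two := htwo_le u hu huz
    rw [h.adj, hz, div_mod_apex_iff]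
    omega
  · intro u hu huz d hd
    have hdk : (d + 1) * (k + 1) ≤ k * (k + 1) :=
      Nat.mul_le_mul_right _ (hd.trans_lt (hgrid u hu huz).1)
    obtain ⟨w, hw⟩ := h.surj ((k + (k + 1) * d) + 2) (by linarith)
    refine ⟨w, ?_, ?_, ?_, ?_⟩
    · rintro rfl
      omega
    · rintro rfl
      omega
    · rw [hw, Nat.add_sub_cancel, Nat.add_mul_div_left _ _ k.succ_pos,
        Nat.div_eq_of_lt k.lt_succ_self, zero_add]
    · rw [hw, Nat.add_sub_cancel, Nat.add_mul_mod_self_left, Nat.mod_eq_of_lt k.lt_succ_self]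

theorem rev (h : IsPathLayout G k pos) : IsPathLayout G k fun u => k * (k + 1) + 1 - pos u where
  inj u w huw := by
    have hu := h.le u
    have hw := h.le w
    dsimp only at huw
    exact h.inj (by omega)
  le u := Nat.sub_le _ _
  surj p hp := by
    obtain ⟨u, hu⟩ := h.surj (k * (k + 1) + 1 - p) (Nat.sub_le _ _)
    exact ⟨u, by omega⟩
  adj u w := by
    have hu := h.le u
    have hw := h.le w
    rw [h.adj]
    omega

open CliqueExpr

theorem exists_builds_of_two_mul_le (h : IsPathLayout G k pos)
    (hhalf : 2 * pos x ≤ k * (k + 1) + 1) :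
    ∃ (l : V → Fin (k + 1)) (e : CliqueExpr V (k + 1)), Builds G {x}ᶜ l e := by
  have := h.finite
  rcases Nat.eq_zero_or_pos (pos x) with hx | hx
  · obtain ⟨z, hz⟩ := h.surj 1 (by omega)
    exact (h.isApexLayout hx hz).exists_builds (Set.toFinite _)
  · obtain ⟨u, hu⟩ := h.surj 0 (Nat.zero_le _)
    refine (h.isColumnLayout hx hhalf).exists_builds (Set.toFinite _) ⟨u, ?_⟩
    rintro rfl
    omega

theorem exists_builds (h : IsPathLayout G k pos) (x : V) :
    ∃ (l : V → Fin (k + 1)) (e : CliqueExpr V (k + 1)), Builds G {x}ᶜ l e := by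
  by_cases hhalf : 2 * pos x ≤ k * (k + 1) + 1
  · exact h.exists_builds_of_two_mul_le hhalf
  · exact h.rev.exists_builds_of_two_mul_le (by omega)

end IsPathLayout

theorem pathPower_adj {k n : ℕ} {u w : Fin n} : (pathPower k n).Adj u w ↔
    (u : ℕ) ≠ w ∧ (u : ℕ) ≤ w + k ∧ (w : ℕ) ≤ u + k := by
  simp only [pathPower, SimpleGraph.fromRel_adj, ne_eq, Fin.ext_iff, Fin.lt_def]
  omega

theorem isPathLayout_graphZ (k : ℕ) :
    IsPathLayout (graphZ k) k (fun u : Fin (k * (k + 1) + 2) => (u : ℕ)) where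
  inj := Fin.val_injective
  le u := Nat.lt_succ_iff.1 u.2
  surj p hp := ⟨⟨p, Nat.lt_succ_of_le hp⟩, rfl⟩
  adj _ _ := pathPower_adj

theorem linearCliqueWidth_induce_graphZ_le {k : ℕ} {S : Set (Fin (k * (k + 1) + 2))}
    (hS : S ≠ Set.univ) : linearCliqueWidth ((graphZ k).induce S) ≤ (k + 1 : ℕ) := by
  obtain ⟨x, hx⟩ := (Set.ne_univ_iff_exists_notMem S).1 hS
  obtain ⟨l, e, h⟩ := (isPathLayout_graphZ k).exists_builds x
  exact h.linearCliqueWidth_induce_le fun u hu hux => hx (hux ▸ hu)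

theorem cliqueWidth_le_linearCliqueWidth {V : Type*} (G : SimpleGraph V) :
    cliqueWidth G ≤ linearCliqueWidth G := by
  refine sInf_le_sInf ?_
  rintro m ⟨k, hm, h⟩
  exact ⟨k, hm, h.imp id fun ⟨e, he⟩ => ⟨e, he.2⟩⟩

/-! ### Twins in a partially coloured path power -/

/-- The vertices `x` and `y` of the path power with vertices `1, …, n` have the same colour, and the
same neighbours outside their colour class. The colour `0` stands for the absence of a colour. -/
def Twin (k n : ℤ) (κ : ℤ → ℕ) (x y : ℤ) : Prop :=
  κ x ≠ 0 ∧ κ y = κ x ∧ ∀ z, 1 ≤ z → z ≤ n → κ z ≠ κ x → (|z - x| ≤ k ↔ |z - y| ≤ k)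

namespace Twin

variable {k n : ℤ} {κ : ℤ → ℕ} {x y z : ℤ}

theorem refl (hx : κ x ≠ 0) : Twin k n κ x x :=
  ⟨hx, rfl, fun _ _ _ _ => Iff.rfl⟩

theorem symm (ht : Twin k n κ x y) : Twin k n κ y x :=
  ⟨by rw [ht.2.1]; exact ht.1, ht.2.1.symm,
    fun z hz hzn hzy => (ht.2.2 z hz hzn (by rwa [← ht.2.1])).symm⟩

theorem trans (hxy : Twin k n κ x y) (hyz : Twin k n κ y z) : Twin k n κ x z :=
  ⟨hxy.1, hyz.2.1.trans hxy.2.1, fun w hw hwn hwx =>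
    (hxy.2.2 w hw hwn hwx).trans (hyz.2.2 w hw hwn (by rwa [hxy.2.1]))⟩

theorem reflect (ht : Twin k n κ x y) :
    Twin k n (fun z => κ (n + 1 - z)) (n + 1 - x) (n + 1 - y) := by
  refine ⟨by simpa using ht.1, by simpa using ht.2.1, fun z hz hzn hzx => ?_⟩
  have hadj := ht.2.2 (n + 1 - z) (by omega) (by omega) (by simpa using hzx)
  rwa [show z - (n + 1 - x) = -((n + 1 - z) - x) by ring,
    show z - (n + 1 - y) = -((n + 1 - z) - y) by ring, abs_neg, abs_neg]

theorem color_eq (ht : Twin k n κ x y) (hz : 1 ≤ z) (hzn : z ≤ n) (hyz : y ≤ z + k)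
    (hzy : z ≤ y + k) (hfar : z + k < x ∨ x + k < z) : κ z = κ x := by
  by_contra hne
  have hzx := (ht.2.2 z hz hzn hne).2 (abs_le.2 ⟨by omega, by omega⟩)
  rw [abs_le] at hzx
  omega

end Twin

/-- The vertex `s` is the leftmost one of its class of twins. -/
def IsTwinStart (k n : ℤ) (κ : ℤ → ℕ) (s : ℤ) : Prop :=
  κ s ≠ 0 ∧ ¬ ∃ w < s, Twin k n κ w s

/-- The vertex `s` is the rightmost one of its class of twins. -/
def IsTwinEnd (k n : ℤ) (κ : ℤ → ℕ) (s : ℤ) : Prop :=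
  κ s ≠ 0 ∧ ¬ ∃ w > s, Twin k n κ s w

theorem IsTwinStart.reflect {k n : ℤ} {κ : ℤ → ℕ} {s : ℤ}
    (hs : IsTwinStart k n (fun z => κ (n + 1 - z)) s) : IsTwinEnd k n κ (n + 1 - s) := by
  refine ⟨hs.1, ?_⟩
  rintro ⟨w, hw, ht⟩
  refine hs.2 ⟨n + 1 - w, by omega, ?_⟩
  simpa using ht.symm.reflect

/-- A colouring of some of the vertices `1, …, n` of a path power without monochromatic interval of
`k + 1` vertices, without uncoloured interval of `k` inner vertices, and with at most `k + 1`
classes of twins. -/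
structure Coloring (k n : ℤ) (κ : ℤ → ℕ) : Prop where
  two_le : 2 ≤ k
  n_eq : n = k * (k + 1) + 2
  range : ∀ x, κ x ≠ 0 → 1 ≤ x ∧ x ≤ n
  not_mono : ∀ j, κ j ≠ 0 → ∃ x, j ≤ x ∧ x ≤ j + k ∧ κ x ≠ κ j
  hit : ∀ i, 2 ≤ i → i + k ≤ n → ∃ x, i ≤ x ∧ x < i + k ∧ κ x ≠ 0
  few : ∀ S : Finset ℤ, (∀ x ∈ S, κ x ≠ 0) → (∀ x ∈ S, ∀ y ∈ S, x < y → ¬ Twin k n κ x y) →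
    (S.card : ℤ) ≤ k + 1

theorem add_le_of_forall_add_le_succ {k : ℤ} (hk : 0 ≤ k) {g : ℕ → ℤ} {N : ℕ}
    (hstep : ∀ i < N, g i + k ≤ g (i + 1)) {i j : ℕ} (hij : i < j) (hj : j ≤ N) :
    g i + k ≤ g j := by
  induction j, hij using Nat.le_induction with
  | base => exact hstep i hj
  | succ m _ ih =>
    have := ih (by omega)
    have := hstep m (by omega)
    omega

theorem exists_chain_of_chains {k x y : ℤ} {κ : ℤ → ℕ} {b I J : ℕ} (hxy : x ≤ y)
    (hI : ∀ i : ℕ, 0 < i → i ≤ I → κ (x - i * k) = b)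
    (hJ : ∀ i : ℕ, i ≤ J → κ (y + i * k) = b) :
    ∃ g : ℕ → ℤ, (∀ i ≤ I + J, κ (g i) = b) ∧ ∀ i < I + J, g i + k ≤ g (i + 1) := by
  -- The chain `x - I * k, …, x - k, y, y + k, …, y + J * k` omits `x`.
  refine ⟨fun i => if i < I then x - ((I - i : ℕ) : ℤ) * k else y + ((i - I : ℕ) : ℤ) * k, ?_, ?_⟩
  · intro i hi
    dsimp only
    split_ifs with hiI
    · exact hI _ (by omega) (by omega)
    · exact hJ _ (by omega)
  · intro i _
    dsimp only
    rcases lt_trichotomy (i + 1) I with hiI | hiI | hiI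
    · rw [if_pos (by omega), if_pos hiI,
        show ((I - i : ℕ) : ℤ) = ((I - (i + 1) : ℕ) : ℤ) + 1 by omega]
      linarith
    · rw [if_pos (by omega), if_neg (by omega), show I - i = 1 by omega,
        show i + 1 - I = 0 by omega]
      push_cast
      linarith
    · rw [if_neg (by omega), if_neg (by omega),
        show ((i + 1 - I : ℕ) : ℤ) = ((i - I : ℕ) : ℤ) + 1 by omega]
      linarith

namespace Coloring

variable {k n : ℤ} {κ : ℤ → ℕ} {x y z j : ℤ}

theorem reflect (h : Coloring k n κ) : Coloring k n fun z => κ (n + 1 - z) where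
  two_le := h.two_le
  n_eq := h.n_eq
  range x hx := by
    have := h.range _ hx
    omega
  not_mono j hj := by
    by_contra! hmono
    have hend : κ (n + 1 - j - k) = κ (n + 1 - j) := by
      have := hmono (j + k) (by linarith [h.two_le]) le_rfl
      rwa [show n + 1 - (j + k) = n + 1 - j - k by ring] at this
    obtain ⟨x, hx, hxk, hne⟩ := h.not_mono (n + 1 - j - k) (by rwa [hend])
    have := hmono (n + 1 - x) (by omega) (by omega)
    exact hne (by rw [hend]; simpa using this)
  hit i hi hin := by
    obtain ⟨x, hx, hxk, hx0⟩ := h.hit (n + 2 - i - k) (by omega) (by omega)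
    exact ⟨n + 1 - x, by omega, by omega, by simpa using hx0⟩
  few S hS hnot := by
    have hcard := h.few (S.image fun z => n + 1 - z) (by
      simp only [Finset.mem_image, forall_exists_index, and_imp, forall_apply_eq_imp_iff₂]
      exact hS) (by
      simp only [Finset.mem_image, forall_exists_index, and_imp, forall_apply_eq_imp_iff₂]
      intro a ha b hb hab ht
      refine hnot b hb a ha (by omega) ?_
      simpa using ht.symm.reflect)
    rwa [Finset.card_image_of_injective _ fun a b hab => by simpa using hab] at hcard

theorem four_mul_le (h : Coloring k n κ) : 4 * k ≤ n := by
  have := h.two_le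
  rw [h.n_eq]
  nlinarith

theorem three_mul_lt (h : Coloring k n κ) : 3 * k + 1 < n := by
  have := h.two_le
  rw [h.n_eq]
  nlinarith

theorem left_le_of_twin_of_add_le (h : Coloring k n κ) (ht : Twin k n κ x y) (hxy : x + k ≤ y) :
    x ≤ k := by
  have hy := h.range y ht.symm.1
  have hk := h.two_le
  by_contra! hkx
  have hmono (z : ℤ) (hz : x - k ≤ z) (hzx : z < x) : κ z = κ x := by
    rw [← ht.2.1]
    exact ht.symm.color_eq (by omega) (by omega) (by omega) (by omega) (by omega)
  have hstart : κ (x - k) = κ x := hmono (x - k) le_rfl (by omega)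
  obtain ⟨z, hz, hzk, hne⟩ := h.not_mono (x - k) (by rw [hstart]; exact ht.1)
  rw [hstart] at hne
  rcases (show z ≤ x by omega).lt_or_eq with hzx | rfl
  · exact hne (hmono z hz hzx)
  · exact hne rfl

theorem lt_add_of_twin (h : Coloring k n κ) (ht : Twin k n κ x y) : y < x + k := by
  by_contra! hlong
  have hx := h.range x ht.1
  have hn := h.four_mul_le
  have hxk : x ≤ k := h.left_le_of_twin_of_add_le ht hlong
  have hyk : n < y + k := by
    have := h.reflect.left_le_of_twin_of_add_le ht.symm.reflect (by omega)
    omega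
  obtain ⟨z, hz, hzk, hne⟩ := h.not_mono x ht.1
  rcases hz.lt_or_eq with hxz | rfl
  · refine hne ?_
    rw [← ht.2.1]
    exact ht.symm.color_eq (by omega) (by omega) (by omega) (by omega) (by omega)
  · exact hne rfl

theorem color_right (h : Coloring k n κ) (ht : Twin k n κ x y) (hxz : x + k < z)
    (hzy : z ≤ y + k) (hzn : z ≤ n) : κ z = κ x := by
  have hx := h.range x ht.1
  have := h.lt_add_of_twin ht
  have := h.two_le
  exact ht.color_eq (by omega) hzn (by omega) hzy (Or.inr hxz)

theorem color_left (h : Coloring k n κ) (ht : Twin k n κ x y) (hxz : x ≤ z + k)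
    (hzy : z + k < y) (hz : 1 ≤ z) : κ z = κ x := by
  have hy := h.range y ht.symm.1
  have := h.lt_add_of_twin ht
  have := h.two_le
  rw [← ht.2.1]
  exact ht.symm.color_eq hz (by omega) hxz (by omega) (Or.inl hzy)

theorem twin_of_lt_of_lt (h : Coloring k n κ) (ht : Twin k n κ x y) (hxz : x < z) (hzy : z < y)
    (hz : κ z = κ x) : Twin k n κ x z := by
  refine ⟨ht.1, hz, fun w hw hwn hwx => ?_⟩
  have := ht.2.2 w hw hwn hwx
  have := h.lt_add_of_twin ht
  simp only [abs_le] at *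
  omega

theorem not_twin_of_le (h : Coloring k n κ) (hxy : x + k ≤ y) : ¬ Twin k n κ x y := fun ht => by
  have := h.two_le
  have := h.lt_add_of_twin ht
  omega

theorem exists_isTwinStart_twin (h : Coloring k n κ) (hx : κ x ≠ 0) :
    ∃ s, IsTwinStart k n κ s ∧ Twin k n κ s x := by
  obtain ⟨s, hs, hleast⟩ := Int.exists_least_of_bdd (P := fun z => Twin k n κ z x)
    ⟨1, fun z hz => (h.range z hz.1).1⟩ ⟨x, Twin.refl hx⟩
  refine ⟨s, ⟨hs.1, ?_⟩, hs⟩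
  rintro ⟨w, hw, hws⟩
  have := hleast w (hws.trans hs)
  omega

theorem exists_not_twin_of_color_ne (h : Coloring k n κ) (hxy : x < y) (hx0 : κ x ≠ 0)
    (hy0 : κ y ≠ 0) {b : ℕ} (hx : κ x ≠ b) (hy : κ y ≠ b) :
    ∃ u v, u < v ∧ κ u ≠ 0 ∧ κ v ≠ 0 ∧ κ u ≠ b ∧ κ v ≠ b ∧ ¬ Twin k n κ u v := by
  by_cases hc : κ y = κ x
  · obtain ⟨u, hu, hleast⟩ := Int.exists_least_of_bdd (P := fun z => κ z = κ x)
      ⟨1, fun z hz => (h.range z (by rwa [hz])).1⟩ ⟨x, rfl⟩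
    obtain ⟨v, hv, hgreatest⟩ := Int.exists_greatest_of_bdd (P := fun z => κ z = κ x)
      ⟨n, fun z hz => (h.range z (by rwa [hz])).2⟩ ⟨x, rfl⟩
    have huv : u < v := (hleast x rfl).trans_lt (hxy.trans_le (hgreatest y hc))
    refine ⟨u, v, huv, by rwa [hu], by rwa [hv], by rwa [hu], by rwa [hv], fun ht => ?_⟩
    have := h.lt_add_of_twin ht
    have := h.three_mul_lt
    have hun : n < u + k + 1 := by
      by_contra! hun
      have := hgreatest _ ((h.color_right ht (by omega) (by omega) hun).trans hu)
      omega
    have hv1 : v - k - 1 < 1 := by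
      by_contra! hv1
      have := hleast _ ((h.color_left ht (by omega) (by omega) hv1).trans hu)
      omega
    omega
  · exact ⟨x, y, hxy, hx0, hy0, hx, hy, fun ht => hc ht.2.1⟩

theorem exists_color_ne (h : Coloring k n κ) (hj : ∀ z, j ≤ z → z ≤ j + k → κ z ≠ 0) (b : ℕ) :
    ∃ z, κ z ≠ 0 ∧ κ z ≠ b := by
  have hk := h.two_le
  by_cases hb : κ j = b
  · obtain ⟨z, hz, hzk, hne⟩ := h.not_mono j (hj j le_rfl (by omega))
    exact ⟨z, hj z hz hzk, by rwa [← hb]⟩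
  · exact ⟨j, hj j le_rfl (by omega), hb⟩

/-! ### Chains of equally coloured vertices -/

theorem exists_finset_of_chain (h : Coloring k n κ) {b : ℕ} {g : ℕ → ℤ} {N : ℕ}
    (hcolor : ∀ i ≤ N, κ (g i) = b) (hstep : ∀ i < N, g i + k ≤ g (i + 1)) :
    ∃ S : Finset ℤ, S.card = N + 1 ∧ (∀ x ∈ S, κ x = b) ∧
      ∀ x ∈ S, ∀ y ∈ S, x < y → ¬ Twin k n κ x y := by
  have hk := h.two_le
  have hmono {i j : ℕ} (hij : i < j) (hj : j ≤ N) : g i + k ≤ g j :=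
    add_le_of_forall_add_le_succ (by omega) hstep hij hj
  let S := (Finset.range (N + 1)).image g
  have hS {x : ℤ} : x ∈ S ↔ ∃ i ≤ N, g i = x := by simp [S]
  refine ⟨S, ?_, fun x hx => ?_, fun x hx y hy hxy => ?_⟩
  · refine (Finset.card_image_of_injOn fun i hi j hj hij => ?_).trans (Finset.card_range _)
    simp only [Finset.coe_range, Set.mem_Iio] at hi hj
    rcases lt_trichotomy i j with hlt | heq | hlt
    · have := hmono hlt (by omega)
      omega
    · exact heq
    · have := hmono hlt (by omega)
      omega
  · obtain ⟨i, hi, rfl⟩ := hS.1 hx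
    exact hcolor i hi
  · obtain ⟨i, hi, rfl⟩ := hS.1 hx
    obtain ⟨j, hj, rfl⟩ := hS.1 hy
    rcases lt_trichotomy i j with hlt | rfl | hlt
    · exact h.not_twin_of_le (hmono hlt hj)
    · exact (lt_irrefl _ hxy).elim
    · have := hmono hlt hi
      omega

theorem length_add_card_le (h : Coloring k n κ) {b : ℕ} (hb : b ≠ 0) {g : ℕ → ℤ} {N : ℕ}
    (hcolor : ∀ i ≤ N, κ (g i) = b) (hstep : ∀ i < N, g i + k ≤ g (i + 1)) (T : Finset ℤ)
    (hT : ∀ x ∈ T, κ x ≠ 0 ∧ κ x ≠ b) (hnot : ∀ x ∈ T, ∀ y ∈ T, x < y → ¬ Twin k n κ x y) :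
    (N : ℤ) + T.card ≤ k := by
  obtain ⟨S, hScard, hScolor, hSnot⟩ := h.exists_finset_of_chain hcolor hstep
  have hdisj : Disjoint S T :=
    Finset.disjoint_left.2 fun x hx hxT => (hT x hxT).2 (hScolor x hx)
  have hcard := h.few (S ∪ T) (fun x hx => by
    rcases Finset.mem_union.1 hx with hx | hx
    · rwa [hScolor x hx]
    · exact (hT x hx).1) (fun x hx y hy hxy ht => by
    rcases Finset.mem_union.1 hx with hx | hx <;> rcases Finset.mem_union.1 hy with hy | hy
    · exact hSnot x hx y hy hxy ht
    · exact (hT y hy).2 (by rw [ht.2.1, hScolor x hx])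
    · exact (hT x hx).2 (by rw [← ht.2.1, hScolor y hy])
    · exact hnot x hx y hy hxy ht)
  rw [Finset.card_union_of_disjoint hdisj, hScard] at hcard
  push_cast at hcard
  linarith

theorem length_lt (h : Coloring k n κ) {b : ℕ} (hb : b ≠ 0) {g : ℕ → ℤ} {N : ℕ}
    (hcolor : ∀ i ≤ N, κ (g i) = b) (hstep : ∀ i < N, g i + k ≤ g (i + 1))
    (hj : ∀ z, j ≤ z → z ≤ j + k → κ z ≠ 0) : (N : ℤ) + 1 ≤ k := by
  obtain ⟨c, hc, hcb⟩ := h.exists_color_ne hj b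
  simpa using h.length_add_card_le hb hcolor hstep {c} (by simp [hc, hcb]) (by simp)

theorem exists_chain_right (h : Coloring k n κ) (hy : ∃ x < y, Twin k n κ x y) :
    ∃ J : ℕ, (∀ i : ℕ, i ≤ J → κ (y + i * k) = κ y) ∧
      (n < y + J * k + k ∨ (0 < J ∧ IsTwinStart k n κ (y + J * k))) := by
  have hk := h.two_le
  generalize hm : (n - y).toNat = m
  induction m using Nat.strong_induction_on generalizing y with
  | _ m ih =>
    obtain ⟨x, hxy, ht⟩ := hy
    have hyn := (h.range y ht.symm.1).2
    by_cases hend : n < y + k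
    · exact ⟨0, fun i hi => by simp [Nat.le_zero.1 hi], Or.inl (by simpa using hend)⟩
    have hc : κ (y + k) = κ y := by
      rw [h.color_right ht (by omega) le_rfl (by omega), ht.2.1]
    by_cases hstart : ∃ x < y + k, Twin k n κ x (y + k)
    · obtain ⟨J, hJ, hlast⟩ := ih _ (by omega) hstart rfl
      have hsucc (i : ℕ) : y + ((i + 1 : ℕ) : ℤ) * k = y + k + i * k := by push_cast; ring
      refine ⟨J + 1, fun i hi => ?_, ?_⟩
      · rcases i with _ | i
        · simp
        · rw [hsucc, hJ i (by omega), hc]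
      · rw [hsucc]
        exact hlast.imp id fun hlast => ⟨by omega, hlast.2⟩
    · refine ⟨1, fun i hi => ?_, Or.inr ⟨one_pos, ?_⟩⟩
      · interval_cases i
        · simp
        · simpa using hc
      · rw [Nat.cast_one, one_mul]
        exact ⟨by rw [hc]; exact ht.symm.1, hstart⟩

theorem exists_chain_left (h : Coloring k n κ) (hx : ∃ y > x, Twin k n κ x y) :
    ∃ I : ℕ, (∀ i : ℕ, i ≤ I → κ (x - i * k) = κ x) ∧
      (x - I * k ≤ k ∨ (0 < I ∧ IsTwinEnd k n κ (x - I * k))) := by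
  obtain ⟨y, hxy, ht⟩ := hx
  obtain ⟨I, hI, hlast⟩ := h.reflect.exists_chain_right (y := n + 1 - x)
    ⟨n + 1 - y, by omega, ht.symm.reflect⟩
  have hrefl (i : ℕ) : n + 1 - (n + 1 - x + i * k) = x - i * k := by ring
  refine ⟨I, fun i hi => ?_, hlast.imp (fun hlast => by linarith) fun hlast => ⟨hlast.1, ?_⟩⟩
  · have := hI i hi
    simp only [hrefl] at this
    simpa using this
  · rw [← hrefl]
    exact hlast.2.reflect

theorem eq_of_color_ne_of_chain (h : Coloring k n κ) {b : ℕ} (hb : b ≠ 0) {g : ℕ → ℤ} {N : ℕ}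
    (hcolor : ∀ i ≤ N, κ (g i) = b) (hstep : ∀ i < N, g i + k ≤ g (i + 1)) (hN : k - 1 ≤ N)
    {u v : ℤ} (hu : κ u ≠ 0) (hub : κ u ≠ b) (hv : κ v ≠ 0) (hvb : κ v ≠ b) : u = v := by
  wlog huv : u < v generalizing u v
  · by_contra hne
    exact hne (this hv hvb hu hub (by omega)).symm
  obtain ⟨u, v, huv, hu, hv, hub, hvb, hnot⟩ :=
    h.exists_not_twin_of_color_ne huv hu hv hub hvb
  have hcard := h.length_add_card_le hb hcolor hstep {u, v} (by simp [*]) (by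
    simp only [Finset.mem_insert, Finset.mem_singleton]
    rintro x (rfl | rfl) y (rfl | rfl) hxy ht
    · exact lt_irrefl _ hxy
    · exact hnot ht
    · exact lt_asymm huv hxy
    · exact lt_irrefl _ hxy)
  rw [Finset.card_pair huv.ne] at hcard
  push_cast at hcard
  omega

theorem span_of_chains (h : Coloring k n κ) (ht : Twin k n κ x y) (hxy : x < y) {I J : ℕ}
    (hI : ∀ i : ℕ, i ≤ I → κ (x - i * k) = κ x) (hJ : ∀ i : ℕ, i ≤ J → κ (y + i * k) = κ y)
    (hj : ∀ z, j ≤ z → z ≤ j + k → κ z ≠ 0) (hjx : j ≤ x) (hyj : y ≤ j + k)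
    (hnext : ∀ z, x < z → z < y → κ z ≠ κ x) (hspan : n - 2 * k ≤ y + J * k - (x - I * k)) :
    y + J * k - (x - I * k) = n - 2 * k ∧ y = x + 2 ∧ ∀ z, κ z ≠ 0 → κ z ≠ κ x → z = x + 1 := by
  have hn := h.n_eq
  obtain ⟨g, hcolor, hstep⟩ := exists_chain_of_chains (b := κ x) hxy.le (fun i _ hi => hI i hi)
    fun i hi => by rw [hJ i hi, ht.2.1]
  have hIJ_le : (I : ℤ) + J ≤ k - 1 := by
    have := h.length_lt ht.1 hcolor hstep hj
    push_cast at this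
    omega
  have hle_IJ : k - 1 ≤ (I : ℤ) + J := by
    by_contra! hlt
    nlinarith
  have hunique {u v : ℤ} (hu : κ u ≠ 0) (hux : κ u ≠ κ x) (hv : κ v ≠ 0) (hvx : κ v ≠ κ x) :
      u = v :=
    h.eq_of_color_ne_of_chain ht.1 hcolor hstep (by push_cast; exact hle_IJ) hu hux hv hvx
  have hgap : y ≤ x + 2 := by
    by_contra! hlt
    have := hunique (hj (x + 1) (by omega) (by omega)) (hnext _ (by omega) (by omega))
      (hj (x + 2) (by omega) (by omega)) (hnext _ (by omega) (by omega))
    omega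
  have hlen : (I : ℤ) * k + J * k = n - 2 * k - 2 := by
    rw [← add_mul, le_antisymm hIJ_le hle_IJ, hn]
    ring
  have hy : y = x + 2 := by linarith
  exact ⟨by linarith, hy, fun z hz hzx => hunique hz hzx (hj _ (by omega) (by omega))
    (hnext _ (by omega) (by omega))⟩

theorem chain_right_end_lt (h : Coloring k n κ) (ht : Twin k n κ x y) (hxy : x < y) {J : ℕ}
    (hJ : ∀ i : ℕ, i ≤ J → κ (y + i * k) = κ y)
    (hj : ∀ z, j ≤ z → z ≤ j + k → κ z ≠ 0) (hy : y ≤ 2 * k + 1) :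
    y + J * k + k < n := by
  by_contra! hspan
  have hk := h.two_le
  have hn := h.n_eq
  have hJx (i : ℕ) (hi : i ≤ J) : κ (y + i * k) = κ x := by rw [hJ i hi, ht.2.1]
  by_cases hyk : y ≤ k + 1
  · obtain ⟨g, hcolor, hstep⟩ := exists_chain_of_chains (k := k) (I := 0) hxy.le (by omega) hJx
    have := h.length_lt ht.1 hcolor hstep hj
    push_cast at this
    nlinarith
  · have hleft : ∀ i : ℕ, 0 < i → i ≤ 1 → κ (y - 1 - i * k) = κ x := by
      intro i hi hi1
      obtain rfl : i = 1 := by omega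
      exact h.color_left ht (by omega) (by omega) (by omega)
    obtain ⟨g, hcolor, hstep⟩ := exists_chain_of_chains (x := y - 1) (I := 1) (by omega) hleft hJx
    have := h.length_lt ht.1 hcolor hstep hj
    push_cast at this
    nlinarith

theorem lt_chain_left_end (h : Coloring k n κ) (ht : Twin k n κ x y) (hxy : x < y) {I : ℕ}
    (hI : ∀ i : ℕ, i ≤ I → κ (x - i * k) = κ x)
    (hj : ∀ z, j ≤ z → z ≤ j + k → κ z ≠ 0) (hx : n ≤ x + 2 * k) :
    k + 1 < x - I * k := by
  have hlt := h.reflect.chain_right_end_lt (J := I) (j := n + 1 - j - k) ht.symm.reflect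
    (by omega) (fun i hi => ?_) (fun z hz hzk => hj _ (by omega) (by omega)) (by omega)
  · linarith
  · rw [show n + 1 - (n + 1 - x + i * k) = x - i * k by ring, hI i hi]
    simp

/-! ### Leftmost and rightmost twins -/

theorem exists_isTwinStart_gt (h : Coloring k n κ) (hx : 1 ≤ x) (hxn : x + k < n) :
    ∃ s, x < s ∧ IsTwinStart k n κ s := by
  obtain ⟨v, hv, -, hv0⟩ := h.hit (x + 1) (by omega) (by omega)
  obtain ⟨u, ⟨hxu, hu0⟩, hleast⟩ := Int.exists_least_of_bdd (P := fun z => x < z ∧ κ z ≠ 0)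
    ⟨x, fun z hz => hz.1.le⟩ ⟨v, by omega, hv0⟩
  by_cases hu : ∃ p < u, Twin k n κ p u
  · obtain ⟨p, hpu, ht⟩ := hu
    have hpx : p ≤ x := by
      by_contra! hxp
      have := hleast p ⟨hxp, ht.1⟩
      omega
    have hc : κ (x + k + 1) = κ p := h.color_right ht (by omega) (by omega) (by omega)
    obtain ⟨s, hs, hst⟩ := h.exists_isTwinStart_twin (x := x + k + 1) (by rw [hc]; exact ht.1)
    refine ⟨s, ?_, hs⟩
    by_contra! hsx
    exact h.not_twin_of_le (by omega) hst
  · exact ⟨u, hxu, hu0, hu⟩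

theorem exists_isTwinStart_le_add (h : Coloring k n κ) (hx : κ x ≠ 0) :
    ∃ s, IsTwinStart k n κ s ∧ n ≤ s + k := by
  obtain ⟨m, hm, -⟩ := h.exists_isTwinStart_twin hx
  obtain ⟨s, hs, hgreatest⟩ := Int.exists_greatest_of_bdd (P := IsTwinStart k n κ)
    ⟨n, fun z hz => (h.range z hz.1).2⟩ ⟨m, hm⟩
  refine ⟨s, hs, ?_⟩
  by_contra! hsn
  obtain ⟨t, hst, ht⟩ := h.exists_isTwinStart_gt (h.range s hs.1).1 hsn
  exact (hgreatest t ht).not_gt hst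

theorem exists_isTwinEnd_le (h : Coloring k n κ) (hx : κ x ≠ 0) :
    ∃ s, IsTwinEnd k n κ s ∧ s ≤ k + 1 := by
  obtain ⟨s, hs, hsn⟩ := h.reflect.exists_isTwinStart_le_add (x := n + 1 - x) (by simpa using hx)
  exact ⟨n + 1 - s, hs.reflect, by omega⟩

theorem exists_prev_twin (h : Coloring k n κ) (hy : ∃ x, j ≤ x ∧ x < y ∧ Twin k n κ x y) :
    ∃ x, j ≤ x ∧ x < y ∧ Twin k n κ x y ∧ ∀ z, x < z → z < y → κ z ≠ κ x := by
  obtain ⟨x, ⟨hjx, hxy, ht⟩, hgreatest⟩ := Int.exists_greatest_of_bdd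
    (P := fun x => j ≤ x ∧ x < y ∧ Twin k n κ x y) ⟨y, fun z hz => hz.2.1.le⟩ hy
  refine ⟨x, hjx, hxy, ht, fun z hxz hzy hz => ?_⟩
  have := hgreatest z ⟨by omega, hzy, (h.twin_of_lt_of_lt ht hxz hzy hz).symm.trans ht⟩
  omega

end Coloring

/-! ### Counting classes of twins -/

theorem eq_of_add_mul_eq_add_mul {k a b j : ℤ} {I J : ℕ} (ha : j ≤ a) (hak : a < j + k)
    (hb : j ≤ b) (hbk : b < j + k) (hab : a + I * k = b + J * k) : a = b := by
  rcases lt_trichotomy I J with hIJ | rfl | hIJ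
  · have : (I : ℤ) + 1 ≤ J := by exact_mod_cast hIJ
    nlinarith
  · linarith
  · have : (J : ℤ) + 1 ≤ I := by exact_mod_cast hIJ
    nlinarith

theorem exists_unique_side_of_card_add_card_le {α β γ : Type*} {Y : Finset α} {L : Finset β}
    {R : Finset γ} {DL DR : α → Prop} {g : α → β} {f : α → γ}
    (hD : ∀ y ∈ Y, DL y ∨ DR y) (hg : ∀ y ∈ Y, DL y → g y ∈ L) (hf : ∀ y ∈ Y, DR y → f y ∈ R)
    (hg_inj : Set.InjOn g {y | y ∈ Y ∧ DL y}) (hf_inj : Set.InjOn f {y | y ∈ Y ∧ DR y})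
    (hcard : L.card + R.card ≤ Y.card) {l : β} (hl : l ∈ L) :
    ∃ y ∈ Y, DL y ∧ ¬ DR y ∧ g y = l := by
  classical
  have hgL : Set.MapsTo g (Y.filter DL) L := fun y hy => by
    obtain ⟨hyY, hyL⟩ := Finset.mem_filter.1 hy
    exact hg y hyY hyL
  have hfR : Set.MapsTo f (Y.filter DR) R := fun y hy => by
    obtain ⟨hyY, hyR⟩ := Finset.mem_filter.1 hy
    exact hf y hyY hyR
  rw [← Finset.coe_filter] at hg_inj hf_inj
  have hcardL : (Y.filter DL).card ≤ L.card := Finset.card_le_card_of_injOn g hgL hg_inj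
  have hcardR : (Y.filter DR).card ≤ R.card := Finset.card_le_card_of_injOn f hfR hf_inj
  have hunion : Y.filter DL ∪ Y.filter DR = Y := by
    rw [← Finset.filter_or, Finset.filter_true_of_mem hD]
  have hinter := Finset.card_union_add_card_inter (Y.filter DL) (Y.filter DR)
  rw [hunion] at hinter
  have hdisj : Y.filter DL ∩ Y.filter DR = ∅ := Finset.card_eq_zero.1 (by omega)
  obtain ⟨y, hy, rfl⟩ := Finset.surjOn_of_injOn_of_card_le g hgL hg_inj (by omega) hl
  obtain ⟨hyY, hyL⟩ := Finset.mem_filter.1 hy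
  refine ⟨y, hyY, hyL, fun hyR => ?_, rfl⟩
  have hmem := Finset.mem_inter.2 ⟨hy, Finset.mem_filter.2 ⟨hyY, hyR⟩⟩
  simp [hdisj] at hmem

/-- Twins `x < y` that are next to each other in their colour class and lie in the window
`j, …, j + k`, with equally coloured vertices at the distances `k, …, I * k` to the left of `x` and
`k, …, J * k` to the right of `y`. Each of the two chains either reaches the first or last `k`
vertices, or leads to the outermost vertex of a class of twins. -/
structure IsTwinChain (k n : ℤ) (κ : ℤ → ℕ) (j x y : ℤ) (I J : ℕ) : Prop where
  le_left : j ≤ x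
  lt : x < y
  right_le : y ≤ j + k
  twin : Twin k n κ x y
  color_ne : ∀ z, x < z → z < y → κ z ≠ κ x
  color_left : ∀ i : ℕ, i ≤ I → κ (x - i * k) = κ x
  color_right : ∀ i : ℕ, i ≤ J → κ (y + i * k) = κ y
  left_end : x - I * k ≤ k ∨ (0 < I ∧ IsTwinEnd k n κ (x - I * k))
  right_end : n < y + J * k + k ∨ (0 < J ∧ IsTwinStart k n κ (y + J * k))

namespace IsTwinChain

variable {k n : ℤ} {κ : ℤ → ℕ} {j x y x' y' : ℤ} {I J I' J' : ℕ}

theorem isTwinEnd (hc : IsTwinChain k n κ j x y I J) (hk : k < x - I * k) :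
    x - I * k < j ∧ IsTwinEnd k n κ (x - I * k) := by
  obtain ⟨hI, hend⟩ := hc.left_end.resolve_left (by omega)
  have := hc.lt
  have := hc.right_le
  have := hc.le_left
  have : (1 : ℤ) ≤ I := by exact_mod_cast hI
  exact ⟨by nlinarith, hend⟩

theorem isTwinStart (hc : IsTwinChain k n κ j x y I J) (hn : y + J * k + k ≤ n) :
    j + k < y + J * k ∧ IsTwinStart k n κ (y + J * k) := by
  obtain ⟨hJ, hstart⟩ := hc.right_end.resolve_left (by omega)
  have := hc.lt
  have := hc.right_le
  have := hc.le_left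
  have : (1 : ℤ) ≤ J := by exact_mod_cast hJ
  exact ⟨by nlinarith, hstart⟩

theorem right_eq_of_left_eq (hc : IsTwinChain k n κ j x y I J)
    (hc' : IsTwinChain k n κ j x y' I' J') : y = y' := by
  rcases lt_trichotomy y y' with hlt | heq | hlt
  · exact (hc'.color_ne y hc.lt hlt hc.twin.2.1).elim
  · exact heq
  · exact (hc.color_ne y' hc'.lt hlt hc'.twin.2.1).elim

theorem right_eq_of_left_end_eq (hc : IsTwinChain k n κ j x y I J)
    (hc' : IsTwinChain k n κ j x' y' I' J') (hend : x - I * k = x' - I' * k) : y = y' := by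
  have hlt := hc.lt.trans_le hc.right_le
  have hlt' := hc'.lt.trans_le hc'.right_le
  obtain rfl : x = x' := eq_of_add_mul_eq_add_mul (I := I') (J := I) hc.le_left hlt hc'.le_left hlt'
    (by linarith)
  exact hc.right_eq_of_left_eq hc'

theorem right_eq_of_right_end_eq (hc : IsTwinChain k n κ j x y I J)
    (hc' : IsTwinChain k n κ j x' y' I' J') (hend : y + J * k = y' + J' * k) : y = y' :=
  eq_of_add_mul_eq_add_mul (Int.add_one_le_iff.2 (hc.le_left.trans_lt hc.lt))
    (by linarith [hc.right_le]) (Int.add_one_le_iff.2 (hc'.le_left.trans_lt hc'.lt))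
    (by linarith [hc'.right_le]) hend

end IsTwinChain

namespace Coloring

variable {k n : ℤ} {κ : ℤ → ℕ} {x y x' y' j : ℤ} {I J I' J' : ℕ}

theorem exists_isTwinChain (h : Coloring k n κ) (hy : ∃ x, j ≤ x ∧ x < y ∧ Twin k n κ x y)
    (hyj : y ≤ j + k) : ∃ (x : ℤ) (I J : ℕ), IsTwinChain k n κ j x y I J := by
  obtain ⟨x, hjx, hxy, ht, hne⟩ := h.exists_prev_twin hy
  obtain ⟨I, hI, hleft⟩ := h.exists_chain_left ⟨y, hxy, ht⟩
  obtain ⟨J, hJ, hright⟩ := h.exists_chain_right ⟨x, hxy, ht⟩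
  exact ⟨x, I, J, hjx, hxy, hyj, ht, hne, hI, hJ, hleft, hright⟩

theorem span_of_isTwinChain (h : Coloring k n κ) (hc : IsTwinChain k n κ j x y I J)
    (hc' : IsTwinChain k n κ j x y I' J') (hj : ∀ z, j ≤ z → z ≤ j + k → κ z ≠ 0)
    (hspan : n - 2 * k ≤ y + J' * k - (x - I * k)) :
    y + J' * k - (x - I * k) = n - 2 * k ∧ y = x + 2 ∧
      ∀ z, κ z ≠ 0 → κ z ≠ κ x → z = x + 1 :=
  h.span_of_chains hc.twin hc.lt hc.color_left hc'.color_right hj hc.le_left hc.right_le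
    hc.color_ne hspan

theorem card_add_card_add_card_le (h : Coloring k n κ) {L C R : Finset ℤ}
    (hL : ∀ s ∈ L, s < j ∧ IsTwinEnd k n κ s) (hR : ∀ s ∈ R, j + k < s ∧ IsTwinStart k n κ s)
    (hC : ∀ y ∈ C, (j ≤ y ∧ y ≤ j + k) ∧ κ y ≠ 0)
    (hnot : ∀ x ∈ C, ∀ y ∈ C, x < y → ¬ Twin k n κ x y) :
    (L.card : ℤ) + C.card + R.card ≤ k + 1 := by
  classical
  have hk := h.two_le
  have hdisj : Disjoint L C := Finset.disjoint_left.2 fun y hyL hyC => by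
    have := hL y hyL
    have := hC y hyC
    omega
  have hdisj' : Disjoint (L ∪ C) R := Finset.disjoint_left.2 fun y hyLC hyR => by
    have := hR y hyR
    rcases Finset.mem_union.1 hyLC with hyL | hyC
    · have := hL y hyL
      omega
    · have := hC y hyC
      omega
  have hcard := h.few (L ∪ C ∪ R)
  simp only [Finset.mem_union] at hcard
  rw [Finset.card_union_of_disjoint hdisj', Finset.card_union_of_disjoint hdisj] at hcard
  push_cast at hcard
  refine hcard ?_ ?_
  · rintro y ((hy | hy) | hy)
    exacts [(hL y hy).2.1, (hC y hy).2, (hR y hy).2.1]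
  · rintro x ((hx | hx) | hx) y ((hy | hy) | hy) hxy ht
    · exact (hL x hx).2.2 ⟨y, hxy, ht⟩
    · exact (hL x hx).2.2 ⟨y, hxy, ht⟩
    · exact (hL x hx).2.2 ⟨y, hxy, ht⟩
    · have := hC x hx
      have := hL y hy
      omega
    · exact hnot x hx y hy hxy ht
    · exact (hR y hy).2.2 ⟨x, hxy, ht⟩
    · have := hR x hx
      have := hL y hy
      omega
    · have := hR x hx
      have := hC y hy
      omega
    · exact (hR y hy).2.2 ⟨x, hxy, ht⟩

theorem exists_card_add_card_le (h : Coloring k n κ) (hj : ∀ z, j ≤ z → z ≤ j + k → κ z ≠ 0) :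
    ∃ L R Y : Finset ℤ, L.card + R.card ≤ Y.card ∧
      (∀ s, s ∈ L ↔ s < j ∧ IsTwinEnd k n κ s) ∧ (∀ s, s ∈ R ↔ j + k < s ∧ IsTwinStart k n κ s) ∧
      ∀ y ∈ Y, y ≤ j + k ∧ ∃ x, j ≤ x ∧ x < y ∧ Twin k n κ x y := by
  classical
  have hk := h.two_le
  have hrange {s : ℤ} (hs : κ s ≠ 0) : s ∈ Finset.Icc 1 n := Finset.mem_Icc.2 (h.range s hs)
  let P (y : ℤ) : Prop := ∃ x, j ≤ x ∧ x < y ∧ Twin k n κ x y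
  let L := (Finset.Icc 1 n).filter fun s => s < j ∧ IsTwinEnd k n κ s
  let R := (Finset.Icc 1 n).filter fun s => j + k < s ∧ IsTwinStart k n κ s
  let Y := (Finset.Icc j (j + k)).filter P
  let C := (Finset.Icc j (j + k)).filter fun y => ¬ P y
  have hL (s : ℤ) : s ∈ L ↔ s < j ∧ IsTwinEnd k n κ s := by
    rw [Finset.mem_filter, and_iff_right_iff_imp]
    exact fun hs => hrange hs.2.1
  have hR (s : ℤ) : s ∈ R ↔ j + k < s ∧ IsTwinStart k n κ s := by
    rw [Finset.mem_filter, and_iff_right_iff_imp]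
    exact fun hs => hrange hs.2.1
  have hC (y : ℤ) : y ∈ C ↔ (j ≤ y ∧ y ≤ j + k) ∧ ¬ P y := by
    rw [Finset.mem_filter, Finset.mem_Icc]
  have hY (y : ℤ) (hy : y ∈ Y) : y ≤ j + k ∧ P y := by
    rw [Finset.mem_filter, Finset.mem_Icc] at hy
    exact ⟨hy.1.2, hy.2⟩
  refine ⟨L, R, Y, ?_, hL, hR, hY⟩
  have hwindow : Y.card + C.card = (Finset.Icc j (j + k)).card :=
    Finset.card_filter_add_card_filter_not _
  rw [Int.card_Icc] at hwindow
  have hclasses := h.card_add_card_add_card_le (C := C) (fun s => (hL s).1) (fun s => (hR s).1)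
    (fun y hy => ⟨((hC y).1 hy).1, hj y ((hC y).1 hy).1.1 ((hC y).1 hy).1.2⟩)
    fun x hx y hy hxy ht => ((hC y).1 hy).2 ⟨x, ((hC x).1 hx).1.1, hxy, ht⟩
  omega

theorem exists_isTwinChain_end_eq (h : Coloring k n κ)
    (hj : ∀ z, j ≤ z → z ≤ j + k → κ z ≠ 0) :
    (∀ s < j, IsTwinEnd k n κ s → ∃ (x y : ℤ) (I J : ℕ), IsTwinChain k n κ j x y I J ∧
      k < x - I * k ∧ n < y + J * k + k ∧ x - I * k = s) ∧
    (∀ s > j + k, IsTwinStart k n κ s → ∃ (x y : ℤ) (I J : ℕ), IsTwinChain k n κ j x y I J ∧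
      x - I * k ≤ k ∧ y + J * k + k ≤ n ∧ y + J * k = s) := by
  obtain ⟨L, R, Y, hcard, hL, hR, hY⟩ := h.exists_card_add_card_le hj
  have hchain (y : ℤ) : ∃ (x : ℤ) (I J : ℕ), y ∈ Y → IsTwinChain k n κ j x y I J := by
    by_cases hy : y ∈ Y
    · obtain ⟨x, I, J, hc⟩ := h.exists_isTwinChain (hY y hy).2 (hY y hy).1
      exact ⟨x, I, J, fun _ => hc⟩
    · exact ⟨0, 0, 0, fun hy' => (hy hy').elim⟩
  choose p I J hc using hchain
  have hside (y : ℤ) (hy : y ∈ Y) : k < p y - I y * k ∨ y + J y * k + k ≤ n := by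
    by_contra! hlong
    have := (h.span_of_isTwinChain (hc y hy) (hc y hy) hj (by linarith)).1
    linarith
  have hleft (y : ℤ) (hy : y ∈ Y) (hk : k < p y - I y * k) : p y - I y * k ∈ L :=
    (hL _).2 ((hc y hy).isTwinEnd hk)
  have hright (y : ℤ) (hy : y ∈ Y) (hn : y + J y * k + k ≤ n) : y + J y * k ∈ R :=
    (hR _).2 ((hc y hy).isTwinStart hn)
  have hleft_inj : Set.InjOn (fun y => p y - I y * k) {y | y ∈ Y ∧ k < p y - I y * k} :=
    fun y hy y' hy' heq => (hc y hy.1).right_eq_of_left_end_eq (hc y' hy'.1) heq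
  have hright_inj : Set.InjOn (fun y => y + J y * k) {y | y ∈ Y ∧ y + J y * k + k ≤ n} :=
    fun y hy y' hy' heq => (hc y hy.1).right_eq_of_right_end_eq (hc y' hy'.1) heq
  refine ⟨fun s hsj hs => ?_, fun s hjs hs => ?_⟩
  · obtain ⟨y, hy, hk, hn, hys⟩ := exists_unique_side_of_card_add_card_le hside hleft hright
      hleft_inj hright_inj hcard ((hL s).2 ⟨hsj, hs⟩)
    exact ⟨p y, y, I y, J y, hc y hy, hk, not_le.1 hn, hys⟩
  · obtain ⟨y, hy, hn, hk, hys⟩ := exists_unique_side_of_card_add_card_le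
      (fun y hy => (hside y hy).symm) hright hleft hright_inj hleft_inj (by omega)
      ((hR s).2 ⟨hjs, hs⟩)
    exact ⟨p y, y, I y, J y, hc y hy, not_lt.1 hk, hn, hys⟩

theorem not_left_long_and_right_long (h : Coloring k n κ)
    (hj : ∀ z, j ≤ z → z ≤ j + k → κ z ≠ 0) {x' y' : ℤ} {I' J' : ℕ}
    (hc : IsTwinChain k n κ j x y I J) (hI : x - I * k ≤ k) (hJ : n - k ≤ y + J * k)
    (hc' : IsTwinChain k n κ j x' y' I' J') (hI' : x' - I' * k ≤ k + 1)
    (hJ' : n < y' + J' * k + k) : False := by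
  obtain ⟨-, hy, honly⟩ := h.span_of_isTwinChain hc hc hj (by linarith)
  obtain ⟨-, hy', honly'⟩ := h.span_of_isTwinChain hc' hc' hj (by linarith)
  by_cases hcolor : κ x' = κ x
  · obtain ⟨c, hc0, hcx⟩ := h.exists_color_ne hj (κ x)
    have hcx_eq := honly c hc0 hcx
    have hcx'_eq := honly' c hc0 (by rwa [hcolor])
    obtain rfl : x = x' := by omega
    obtain rfl : y = y' := by omega
    have := (h.span_of_isTwinChain hc hc' hj (by linarith)).1
    linarith
  · have hx' := honly x' hc'.twin.1 hcolor
    have hy'_eq := honly y' hc'.twin.symm.1 (by rwa [hc'.twin.2.1])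
    omega

theorem exists_eq_zero (h : Coloring k n κ) (j : ℤ) : ∃ z, j ≤ z ∧ z ≤ j + k ∧ κ z = 0 := by
  by_contra! hj
  have hk := h.two_le
  have hn := h.three_mul_lt
  obtain ⟨hends, hstarts⟩ := h.exists_isTwinChain_end_eq hj
  obtain ⟨s, hs, hsn⟩ := h.exists_isTwinStart_le_add (hj j le_rfl (by omega))
  obtain ⟨s', hs', hsk'⟩ := h.exists_isTwinEnd_le (hj j le_rfl (by omega))
  by_cases hjs : j + k < s
  · obtain ⟨x, y, I, J, hc, hI, -, hJs⟩ := hstarts s hjs hs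
    by_cases hsj' : s' < j
    · obtain ⟨x', y', I', J', hc', -, hJ', hIs'⟩ := hends s' hsj' hs'
      exact h.not_left_long_and_right_long hj hc hI (by linarith) hc' (by linarith) hJ'
    · have := h.chain_right_end_lt hc.twin hc.lt hc.color_right hj (by linarith [hc.right_le])
      linarith
  · obtain ⟨x', y', I', J', hc', -, -, hIs'⟩ := hends s' (by omega) hs'
    have := h.lt_chain_left_end hc'.twin hc'.lt hc'.color_left hj (by linarith [hc'.le_left])
    linarith

end Coloring

/-! ### Unions of labelled subgraphs of a path power -/

/-- The disjoint vertex sets `A` and `D` of the operands of a union in an expression for the path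
power with vertices `1, …, n`: vertices with equal labels have the same neighbours that are not yet
created, and adjacencies between `A` and `D` depend on the labels only. -/
structure IsUnion (k n : ℤ) {L : Type*} (A D : ℤ → Prop) (lab : ℤ → L) : Prop where
  range : ∀ x, A x ∨ D x → 1 ≤ x ∧ x ≤ n
  disjoint : ∀ x, A x → ¬ D x
  out : ∀ x y, A x ∨ D x → A y ∨ D y → lab x = lab y → ∀ z, 1 ≤ z → z ≤ n → ¬ A z → ¬ D z →
    |z - x| ≤ k → |z - y| ≤ k
  cross : ∀ x z x' z', A x → D z → A x' ∨ D x' → A z' ∨ D z' → lab x' = lab x → lab z' = lab z →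
    |x - z| ≤ k → x' ≠ z' ∧ |x' - z'| ≤ k

/-- The predicate `A` fails at the `k` consecutive vertices `i, …, i + k - 1` and, further to the
right, holds at the `k + 1` consecutive vertices `j, …, j + k`. -/
structure IsGapBeforeWindow (k : ℤ) (A : ℤ → Prop) (i j : ℤ) : Prop where
  one_le : 1 ≤ i
  gap : ∀ z, i ≤ z → z < i + k → ¬ A z
  le : i + k ≤ j
  window : ∀ z, j ≤ z → z ≤ j + k → A z

namespace IsGapBeforeWindow

variable {K : ℕ} {A : ℤ → Prop} {i j : ℤ}

theorem exists_first_of_residue (h : IsGapBeforeWindow K A i j) {r : ℕ} (hr : r < K) :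
    ∃ v, A v ∧ i + K ≤ v ∧ v < j + K ∧ ¬ A (v - K) ∧ ∃ m : ℕ, v = i + r + m * K := by
  classical
  have hK : (0 : ℤ) < K := by omega
  have hij := h.le
  have hex : ∃ m : ℕ, A (i + r + m * K) ∧ i + r + m * K < j + K := by
    have hdiv := Int.emod_add_mul_ediv (j + K - 1 - (i + r)) K
    have hmod := Int.emod_nonneg (j + K - 1 - (i + r)) hK.ne'
    have hmod_lt := Int.emod_lt_of_pos (j + K - 1 - (i + r)) hK
    refine ⟨((j + K - 1 - (i + r)) / K).toNat, ?_⟩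
    rw [Int.toNat_of_nonneg (Int.ediv_nonneg (by omega) hK.le), mul_comm]
    exact ⟨h.window _ (by omega) (by omega), by omega⟩
  have hm := Nat.find_spec hex
  rcases hm0 : Nat.find hex with _ | m
  · rw [hm0] at hm
    exact (h.gap _ (by omega) (by push_cast; omega) hm.1).elim
  · have hmin := Nat.find_min hex (m := m) (by omega)
    rw [hm0] at hm
    have hsub : i + r + ((m + 1 : ℕ) : ℤ) * K - K = i + r + m * K := by push_cast; ring
    have hpos : (0 : ℤ) ≤ m * K := by positivity
    refine ⟨_, hm.1, by linarith, hm.2, ?_, m + 1, rfl⟩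
    rw [hsub]
    exact fun hA => hmin ⟨hA, by linarith [hm.2]⟩

-- One vertex for each residue modulo `K`, and the last vertex of the window.
theorem exists_injective (h : IsGapBeforeWindow K A i j) :
    ∃ v : Fin (K + 1) → ℤ, Function.Injective v ∧ ∀ r, A (v r) ∧ i + K ≤ v r ∧ v r ≤ j + K ∧
      (v r = j + K ∨ ¬ A (v r - K)) := by
  have hij := h.le
  have hex (r : Fin (K + 1)) : ∃ v, (A v ∧ i + K ≤ v ∧ v ≤ j + K) ∧
      ((v = j + K ∧ (r : ℕ) = K) ∨
        (v < j + K ∧ ¬ A (v - K) ∧ (r : ℕ) < K ∧ ∃ m : ℕ, v = i + (r : ℕ) + m * K)) := by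
    rcases (Nat.lt_succ_iff.1 r.2).lt_or_eq with hr | hr
    · obtain ⟨v, hA, hiv, hvj, hnot, hm⟩ := h.exists_first_of_residue hr
      exact ⟨v, ⟨hA, hiv, hvj.le⟩, Or.inr ⟨hvj, hnot, hr, hm⟩⟩
    · exact ⟨j + K, ⟨h.window _ (by omega) le_rfl, by omega, le_rfl⟩, Or.inl ⟨rfl, hr⟩⟩
  choose v hvA hv using hex
  refine ⟨v, fun r s hrs => ?_, fun r =>
    ⟨(hvA r).1, (hvA r).2.1, (hvA r).2.2, (hv r).imp And.left fun hr => hr.2.1⟩⟩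
  rcases hv r with ⟨hvr, hr⟩ | ⟨hvr, -, hr, m, hm⟩ <;>
    rcases hv s with ⟨hvs, hs⟩ | ⟨hvs, -, hs, m', hm'⟩
  · exact Fin.ext (hr.trans hs.symm)
  · omega
  · omega
  · have := eq_of_add_mul_eq_add_mul (k := K) (j := i) (a := i + (r : ℕ)) (b := i + (s : ℕ))
      (I := m) (J := m') (by omega) (by omega) (by omega) (by omega) (by linarith)
    exact Fin.ext (by omega)

end IsGapBeforeWindow

namespace IsUnion

variable {k n : ℤ} {L : Type*} {A D : ℤ → Prop} {lab : ℤ → L} {x y z : ℤ}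

theorem swap (h : IsUnion k n A D lab) : IsUnion k n D A lab where
  range x hx := h.range x hx.symm
  disjoint x hD hA := h.disjoint x hA hD
  out x y hx hy hxy z hz hzn hD hA := h.out x y hx.symm hy.symm hxy z hz hzn hA hD
  cross x z x' z' hx hz hx' hz' hxx' hzz' hxz := by
    have := h.cross z x z' x' hz hx hz'.symm hx'.symm hzz' hxx' (by rwa [abs_sub_comm])
    rw [abs_sub_comm]
    exact ⟨this.1.symm, this.2⟩

theorem reflect (h : IsUnion k n A D lab) :
    IsUnion k n (fun x => A (n + 1 - x)) (fun x => D (n + 1 - x)) fun x => lab (n + 1 - x) where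
  range x hx := by
    have := h.range _ hx
    omega
  disjoint x := h.disjoint _
  out x y hx hy hxy z hz hzn hA hD hzx := by
    have := h.out _ _ hx hy hxy (n + 1 - z) (by omega) (by omega) hA hD (by
      rw [abs_le] at *
      omega)
    rw [abs_le] at *
    omega
  cross x z x' z' hx hz hx' hz' hxx' hzz' hxz := by
    have := h.cross _ _ _ _ hx hz hx' hz' hxx' hzz' (by
      rw [abs_le] at *
      omega)
    rw [abs_le] at *
    omega

theorem near_of_lab_eq (h : IsUnion k n A D lab) (hx : A x) (hy : A y ∨ D y)
    (hxy : lab x = lab y) (hz : 1 ≤ z) (hzn : z ≤ n) (hzA : ¬ A z) (hzx : |z - x| ≤ k) :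
    |z - y| ≤ k := by
  by_cases hzD : D z
  · rw [abs_sub_comm]
    exact (h.cross x z y z hx hzD hy (Or.inr hzD) hxy.symm rfl (by rwa [abs_sub_comm])).2
  · exact h.out x y (Or.inl hx) hy hxy z hz hzn hzA hzD hzx

theorem far_of_lab_eq (h : IsUnion k n A D lab) (hx : A x) (hy : D y) (hxy : lab x = lab y) :
    x + k < y ∨ y + k < x := by
  by_contra! hnear
  exact (h.cross x y y y hx hy (Or.inr hy) (Or.inr hy) hxy.symm rfl
    (abs_le.2 ⟨by omega, by omega⟩)).1 rfl

theorem lab_ne_of_near_of_far (h : IsUnion k n A D lab) (hx : A x) (hy : A y)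
    (hz : 1 ≤ z) (hzn : z ≤ n) (hzA : ¬ A z) (hzx : |z - x| ≤ k) (hzy : k < |z - y|) :
    lab x ≠ lab y := fun hl =>
  hzy.not_ge (h.near_of_lab_eq hx (Or.inl hy) hl hz hzn hzA hzx)

end IsUnion

/-! ### Unions with an operand that has a window and a gap -/

namespace IsUnion

variable {n : ℤ} {K : ℕ} {A D : ℤ → Prop} {lab : ℤ → Fin (K + 1)} {i j d : ℤ}

-- No two of the `K + 1` vertices of `IsGapBeforeWindow.exists_injective` share a label, so every
-- label occurs among them.
theorem exists_lab_eq (h : IsUnion K n A D lab) (hg : IsGapBeforeWindow K A i j)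
    (l : Fin (K + 1)) :
    ∃ v, A v ∧ lab v = l ∧ i + K ≤ v ∧ v ≤ j + K ∧ (v = j + K ∨ ¬ A (v - K)) := by
  obtain ⟨v, hv_inj, hv⟩ := hg.exists_injective
  have hlab_ne {r s : Fin (K + 1)} (hrs : v r < v s) : lab (v r) ≠ lab (v s) := by
    obtain ⟨hAr, hir, -, hr⟩ := hv r
    obtain ⟨hAs, -, hsj, -⟩ := hv s
    have := hg.one_le
    have := h.range _ (Or.inl hAr)
    exact h.lab_ne_of_near_of_far hAr hAs (z := v r - K) (by omega) (by omega)
      (hr.resolve_left (by omega)) (by rw [abs_le]; omega) (by rw [lt_abs]; omega)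
  have hinj : Function.Injective fun r => lab (v r) := by
    intro r s hrs
    by_contra hne
    rcases (hv_inj.ne hne).lt_or_gt with hlt | hlt
    · exact hlab_ne hlt hrs
    · exact hlab_ne hlt hrs.symm
  obtain ⟨r, hr⟩ := Finite.injective_iff_surjective.1 hinj l
  exact ⟨v r, (hv r).1, hr, (hv r).2⟩

theorem lab_eq_or_exists_lab_eq (h : IsUnion K n A D lab) (hg : IsGapBeforeWindow K A i j)
    (hd : D d) : (lab d = lab (j + K) ∧ j + 2 * K < d) ∨
      ∃ v, A v ∧ lab v = lab d ∧ d + K < v ∧ v ≤ j + K := by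
  have := hg.one_le
  obtain ⟨v, hv, hlab, hiv, hvj, hvK⟩ := h.exists_lab_eq hg (lab d)
  have hfar := h.far_of_lab_eq hv hd hlab
  rcases hvK with rfl | hvK
  · rcases hfar with hfar | hfar
    · exact Or.inl ⟨hlab.symm, by omega⟩
    · exact Or.inr ⟨_, hv, hlab, hfar, le_rfl⟩
  · have := h.range _ (Or.inl hv)
    have hnear := h.near_of_lab_eq hv (Or.inr hd) hlab (z := v - K) (by omega) (by omega) hvK
      (by rw [abs_le]; omega)
    rw [abs_le] at hnear
    exact Or.inr ⟨v, hv, hlab, by omega, hvj⟩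

theorem eq_of_lt (h : IsUnion K n A D lab) (hK : 2 ≤ K) (hg : IsGapBeforeWindow K A i j)
    (hd : D d) (hjd : j + 2 * K < d) : d = n := by
  by_contra hdn
  have := hg.one_le
  have := hg.le
  have hdn' := (h.range d (Or.inr hd)).2
  obtain ⟨m, ⟨hmD, hjm⟩, hleast⟩ := Int.exists_least_of_bdd (P := fun d => D d ∧ j + 2 * K < d)
    ⟨1, fun z hz => (h.range z (Or.inr hz.1)).1⟩ ⟨d, hd, hjd⟩
  have hmd := hleast d ⟨hd, hjd⟩
  have hlast : A (j + K) := hg.window _ (by omega) le_rfl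
  have hlab {e : ℤ} (he : D e) (hje : j + 2 * K < e) : lab e = lab (j + K) := by
    rcases h.lab_eq_or_exists_lab_eq hg he with hlab | ⟨v, -, -, hev, hvj⟩
    · exact hlab.1
    · omega
  have hD : D (m + 1) := by
    by_contra hD
    have hnear := h.swap.near_of_lab_eq hmD (Or.inr hlast) (hlab hmD hjm) (z := m + 1) (by omega)
      (by omega) hD (by rw [abs_le]; omega)
    rw [abs_le] at hnear
    omega
  have hmK : ¬ D (m - K) := by
    intro hmK
    rcases h.lab_eq_or_exists_lab_eq hg hmK with ⟨-, hjm'⟩ | ⟨v, -, -, hmv, hvj⟩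
    · have := hleast _ ⟨hmK, hjm'⟩
      omega
    · omega
  exact h.swap.lab_ne_of_near_of_far hmD hD (z := m - K) (by omega) (by omega) hmK
    (by rw [abs_le]; omega) (by rw [lt_abs]; omega)
    ((hlab hmD hjm).trans (hlab hD (by omega)).symm)

theorem eq_one_of_lt (h : IsUnion K n A D lab) (hK : 2 ≤ K) (hg : IsGapBeforeWindow K A i j)
    (hd : D d) (hdj : d < j) : d = 1 := by
  by_contra hd1
  have hjn := (h.range _ (Or.inl (hg.window (j + K) (by omega) le_rfl))).2
  have hd1' := (h.range d (Or.inr hd)).1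
  obtain ⟨m, ⟨hmD, hmj⟩, hgreatest⟩ := Int.exists_greatest_of_bdd (P := fun d => D d ∧ d < j)
    ⟨j, fun z hz => hz.2.le⟩ ⟨d, hd, hdj⟩
  have hdm := hgreatest d ⟨hd, hdj⟩
  have hnot (e : ℤ) (hme : m < e) (hej : e ≤ j + 2 * K) : ¬ D e := by
    intro he
    rcases h.lab_eq_or_exists_lab_eq hg he with ⟨-, hje⟩ | ⟨v, -, -, hev, hvj⟩
    · omega
    · have := hgreatest e ⟨he, by omega⟩
      omega
  obtain ⟨v, hvA, hvm, hmv, -⟩ := (h.lab_eq_or_exists_lab_eq hg hmD).resolve_left (by omega)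
  have hnear {z : ℤ} (hz : 1 ≤ z) (hzn : z ≤ n) (hzD : ¬ D z) (hzm : |z - m| ≤ K) : |z - v| ≤ K :=
    h.swap.near_of_lab_eq hmD (Or.inr hvA) hvm.symm hz hzn hzD hzm
  have hvm1 := hnear (z := m + 1) (by omega) (by omega) (hnot _ (by omega) (by omega))
    (by rw [abs_le]; omega)
  rw [abs_le] at hvm1
  have hD : D (m - 1) := by
    by_contra hD
    have := hnear (z := m - 1) (by omega) (by omega) hD (by rw [abs_le]; omega)
    rw [abs_le] at this
    omega
  obtain ⟨w, hwA, hwm, hmw, -⟩ := (h.lab_eq_or_exists_lab_eq hg hD).resolve_left (by omega)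
  have hwm1 := h.swap.near_of_lab_eq hD (Or.inr hwA) hwm.symm (z := m + 1) (by omega) (by omega)
    (hnot _ (by omega) (by omega)) (by rw [abs_le]; omega)
  have hne := h.swap.lab_ne_of_near_of_far hmD hD (z := m + K) (by omega) (by omega)
    (hnot _ (by omega) (by omega)) (by rw [abs_le]; omega) (by rw [lt_abs]; omega)
  rw [abs_le] at hwm1
  have hvw : v ≠ w := by
    rintro rfl
    exact hne (hvm.symm.trans hwm)
  have hcross := h.cross w m (m - 1) v hwA hmD (Or.inr hD) (Or.inl hvA) hwm.symm hvm
    (by rw [abs_le]; omega)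
  rw [abs_le] at hcross
  omega

theorem eq_one_or_eq (h : IsUnion K n A D lab) (hK : 2 ≤ K) (hg : IsGapBeforeWindow K A i j)
    (hd : D d) : d = 1 ∨ d = n := by
  rcases h.lab_eq_or_exists_lab_eq hg hd with ⟨-, hjd⟩ | ⟨v, -, -, hdv, hvj⟩
  · exact Or.inr (h.eq_of_lt hK hg hd hjd)
  · exact Or.inl (h.eq_one_of_lt hK hg hd (by omega))

end IsUnion

/-- The predicate `A` holds at some `k + 1` consecutive integers. -/
def HasWindow (k : ℤ) (A : ℤ → Prop) : Prop :=
  ∃ j, ∀ z, j ≤ z → z ≤ j + k → A z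

/-- The predicate `A` fails at some `k` consecutive inner vertices of the path power with vertices
`1, …, n`. The end vertices are excluded because a union may create them without filling a gap. -/
def HasGap (k n : ℤ) (A : ℤ → Prop) : Prop :=
  ∃ i, 2 ≤ i ∧ i + k ≤ n ∧ ∀ z, i ≤ z → z < i + k → ¬ A z

theorem IsUnion.hasGap_of_hasGap {n : ℤ} {K : ℕ} {A D : ℤ → Prop} {lab : ℤ → Fin (K + 1)}
    (h : IsUnion K n A D lab) (hK : 2 ≤ K) (hw : HasWindow K A) (hg : HasGap K n A) :
    HasGap K n fun x => A x ∨ D x := by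
  obtain ⟨j, hj⟩ := hw
  obtain ⟨i, hi2, hin, hi⟩ := hg
  suffices hends : ∀ d, D d → d = 1 ∨ d = n from
    ⟨i, hi2, hin, fun z hiz hzi hz => hz.elim (hi z hiz hzi) fun hz => by
      have := hends z hz
      omega⟩
  intro d hd
  rcases le_or_gt (i + K) j with hij | hij
  · exact h.eq_one_or_eq hK ⟨by omega, hi, hij, hj⟩ hd
  · have hji : j + K < i := by
      by_contra! hji
      exact hi (max i j) (by omega) (by omega) (hj _ (by omega) (by omega))
    have hg' : IsGapBeforeWindow K (fun x => A (n + 1 - x)) (n + 2 - i - K) (n + 1 - j - K) :=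
      ⟨by omega, fun z _ _ => hi _ (by omega) (by omega), by omega,
        fun z _ _ => hj _ (by omega) (by omega)⟩
    have := h.reflect.eq_one_or_eq hK hg' (d := n + 1 - d) (by simpa using hd)
    omega

/-! ### Unions without an operand that has a window -/

open Classical in
/-- Colour `1` for the vertices of the first operand of a union, `2` for those of the second, and
`0` for the vertices that are not yet created. -/
noncomputable def unionColoring (A D : ℤ → Prop) (x : ℤ) : ℕ :=
  if A x then 1 else if D x then 2 else 0

theorem unionColoring_ne_zero {A D : ℤ → Prop} {x : ℤ} :
    unionColoring A D x ≠ 0 ↔ A x ∨ D x := by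
  unfold unionColoring
  split_ifs <;> simp [*]

theorem unionColoring_eq_one {A D : ℤ → Prop} {x : ℤ} : unionColoring A D x = 1 ↔ A x := by
  unfold unionColoring
  split_ifs <;> simp [*]

namespace IsUnion

variable {n : ℤ} {K : ℕ} {A D : ℤ → Prop} {x y : ℤ}

theorem unionColoring_eq_two {k : ℤ} {L : Type*} {lab : ℤ → L} (h : IsUnion k n A D lab) :
    unionColoring A D x = 2 ↔ D x := by
  have := h.disjoint x
  unfold unionColoring
  split_ifs <;> simp_all

theorem lab_ne_of_lt {L : Type*} {lab : ℤ → L} (h : IsUnion K n A D lab) (hn : 4 * (K : ℤ) ≤ n)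
    (hA : ¬ HasWindow K A) (hD : ¬ HasWindow K D) (hx : A x) (hy : D y) (hxy : x < y) :
    lab x ≠ lab y := by
  intro hlab
  have hfar := (h.far_of_lab_eq hx hy hlab).resolve_right (by omega)
  have hx1 := h.range x (Or.inl hx)
  have hy1 := h.range y (Or.inr hy)
  have hA_near (z : ℤ) (hz : 1 ≤ z) (hzn : z ≤ n) (hxz : x - K ≤ z) (hzx : z ≤ x + K)
      (hzy : z < y - K ∨ y + K < z) : A z := by
    by_contra hzA
    have := h.near_of_lab_eq hx (Or.inr hy) hlab hz hzn hzA (by rw [abs_le]; omega)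
    rw [abs_le] at this
    omega
  have hD_near (z : ℤ) (hz : 1 ≤ z) (hzn : z ≤ n) (hyz : y - K ≤ z) (hzy : z ≤ y + K)
      (hzx : z < x - K ∨ x + K < z) : D z := by
    by_contra hzD
    have := h.swap.near_of_lab_eq hy (Or.inr hx) hlab.symm hz hzn hzD (by rw [abs_le]; omega)
    rw [abs_le] at this
    omega
  have hxK : x ≤ K := by
    by_contra! hKx
    exact hA ⟨x - K, fun z _ _ => hA_near z (by omega) (by omega) (by omega) (by omega) (by omega)⟩
  have hyK : n < y + K := by
    by_contra! hyn
    exact hD ⟨y, fun z _ _ => hD_near z (by omega) (by omega) (by omega) (by omega) (by omega)⟩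
  exact hA ⟨x, fun z _ _ => hA_near z (by omega) (by omega) (by omega) (by omega) (by omega)⟩

theorem lab_ne {L : Type*} {lab : ℤ → L} (h : IsUnion K n A D lab) (hn : 4 * (K : ℤ) ≤ n)
    (hA : ¬ HasWindow K A) (hD : ¬ HasWindow K D) (hx : A x) (hy : D y) : lab x ≠ lab y := by
  rcases lt_trichotomy x y with hxy | rfl | hxy
  · exact h.lab_ne_of_lt hn hA hD hx hy hxy
  · exact (h.disjoint _ hx hy).elim
  · exact (h.swap.lab_ne_of_lt hn hD hA hy hx hxy).symm

theorem twin_of_lab_eq {L : Type*} {lab : ℤ → L} (h : IsUnion K n A D lab)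
    (hn : 4 * (K : ℤ) ≤ n) (hA : ¬ HasWindow K A) (hD : ¬ HasWindow K D)
    (hx : A x ∨ D x) (hy : A y ∨ D y) (hlab : lab x = lab y) :
    Twin K n (unionColoring A D) x y := by
  refine ⟨unionColoring_ne_zero.2 hx, ?_⟩
  rcases hx with hx | hx <;> rcases hy with hy | hy
  · rw [unionColoring_eq_one.2 hx, unionColoring_eq_one.2 hy]
    refine ⟨rfl, fun z hz hzn hzc => ?_⟩
    rw [Ne, unionColoring_eq_one] at hzc
    exact ⟨h.near_of_lab_eq hx (Or.inl hy) hlab hz hzn hzc,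
      h.near_of_lab_eq hy (Or.inl hx) hlab.symm hz hzn hzc⟩
  · exact (h.lab_ne hn hA hD hx hy hlab).elim
  · exact (h.lab_ne hn hA hD hy hx hlab.symm).elim
  · rw [h.unionColoring_eq_two.2 hx, h.unionColoring_eq_two.2 hy]
    refine ⟨rfl, fun z hz hzn hzc => ?_⟩
    rw [Ne, h.unionColoring_eq_two] at hzc
    exact ⟨h.swap.near_of_lab_eq hx (Or.inl hy) hlab hz hzn hzc,
      h.swap.near_of_lab_eq hy (Or.inl hx) hlab.symm hz hzn hzc⟩

variable {lab : ℤ → Fin (K + 1)}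

theorem card_le_of_forall_not_twin (h : IsUnion K n A D lab) (hn : 4 * (K : ℤ) ≤ n)
    (hA : ¬ HasWindow K A) (hD : ¬ HasWindow K D) {S : Finset ℤ}
    (hS : ∀ x ∈ S, unionColoring A D x ≠ 0)
    (htwin : ∀ x ∈ S, ∀ y ∈ S, x < y → ¬ Twin K n (unionColoring A D) x y) :
    S.card ≤ K + 1 := by
  have hlab : Set.InjOn lab S := by
    intro x hx y hy hxy
    have hxAD := unionColoring_ne_zero.1 (hS x hx)
    have hyAD := unionColoring_ne_zero.1 (hS y hy)
    by_contra hne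
    rcases lt_or_gt_of_ne hne with hlt | hlt
    · exact htwin x hx y hy hlt (h.twin_of_lab_eq hn hA hD hxAD hyAD hxy)
    · exact htwin y hy x hx hlt (h.twin_of_lab_eq hn hA hD hyAD hxAD hxy.symm)
  simpa using Finset.card_le_card_of_injOn (t := Finset.univ) lab (fun _ _ => Finset.mem_univ _)
    hlab

theorem coloring (h : IsUnion K n A D lab) (hK : 2 ≤ K) (hn : n = K * (K + 1) + 2)
    (hA : ¬ HasWindow K A) (hD : ¬ HasWindow K D) (hg : ¬ HasGap K n fun x => A x ∨ D x) :
    Coloring K n (unionColoring A D) where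
  two_le := by exact_mod_cast hK
  n_eq := hn
  range x hx := h.range x (unionColoring_ne_zero.1 hx)
  not_mono j hj := by
    by_contra! hmono
    rcases unionColoring_ne_zero.1 hj with hj | hj
    · exact hA ⟨j, fun z hjz hzj =>
        unionColoring_eq_one.1 ((hmono z hjz hzj).trans (unionColoring_eq_one.2 hj))⟩
    · exact hD ⟨j, fun z hjz hzj =>
        h.unionColoring_eq_two.1 ((hmono z hjz hzj).trans (h.unionColoring_eq_two.2 hj))⟩
  hit i hi hin := by
    by_contra! hzero
    exact hg ⟨i, hi, hin, fun z hiz hzi hz => unionColoring_ne_zero.2 hz (hzero z hiz hzi)⟩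
  few S hS htwin := by
    have hn4 : 4 * (K : ℤ) ≤ n := by
      rw [hn]
      nlinarith
    exact_mod_cast h.card_le_of_forall_not_twin hn4 hA hD hS htwin

theorem hasGap (h : IsUnion K n A D lab) (hK : 2 ≤ K) (hn : n = K * (K + 1) + 2)
    (hA : HasWindow K A → HasGap K n A) (hD : HasWindow K D → HasGap K n D)
    (hw : HasWindow K fun x => A x ∨ D x) : HasGap K n fun x => A x ∨ D x := by
  by_cases hAw : HasWindow K A
  · exact h.hasGap_of_hasGap hK hAw (hA hAw)
  by_cases hDw : HasWindow K D
  · simpa only [or_comm] using h.swap.hasGap_of_hasGap hK hDw (hD hDw)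
  by_contra hg
  obtain ⟨j, hj⟩ := hw
  obtain ⟨z, hjz, hzj, hz⟩ := (h.coloring hK hn hAw hDw hg).exists_eq_zero j
  exact unionColoring_ne_zero.2 (hj z hjz hzj) hz

end IsUnion

/-! ### Subexpressions of an expression that defines a graph -/

namespace CliqueExpr

variable {V : Type*} {m : ℕ}

/-- The labelled graph defined by `e` can be extended to `G`: vertices with equal labels have the
same neighbours among the vertices not yet created, and whether an edge between created vertices is
still missing depends on the labels only. -/
structure Compatible (G : SimpleGraph V) (e : CliqueExpr V m) : Prop where
  graph_le : e.graph ≤ G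
  outside : ∀ u w a, e.HasLabel u a → e.HasLabel w a → ∀ z, z ∉ e.verts → G.Adj u z → G.Adj w z
  missing : ∀ u w u' w' a b, e.HasLabel u a → e.HasLabel u' a → e.HasLabel w b → e.HasLabel w' b →
    G.Adj u w → ¬ e.graph.Adj u w → G.Adj u' w'

variable {G : SimpleGraph V} {e f : CliqueExpr V m} {i j : Fin m}

theorem Defines.compatible (h : e.Defines G) : e.Compatible G where
  graph_le := h.2.2.le
  outside _ _ _ _ _ z hz := (hz (h.2.1 ▸ Set.mem_univ z)).elim
  missing _ _ _ _ _ _ _ _ _ _ hadj hmissing := (hmissing (h.2.2.symm ▸ hadj)).elim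

namespace Compatible

theorem adj_of_union (h : (union e f).Compatible G) (hd : Disjoint e.verts f.verts)
    {x z x' z' : V} {a b : Fin m} (hx : e.HasLabel x a) (hz : f.HasLabel z b)
    (hx' : (union e f).HasLabel x' a) (hz' : (union e f).HasLabel z' b) (hxz : G.Adj x z) :
    G.Adj x' z' := by
  refine h.missing x z x' z' a b (Or.inl hx) hx' (Or.inr hz) hz' hxz ?_
  rintro (he | hf)
  · exact Set.disjoint_left.1 hd (mem_verts_of_adj he).2 hz.mem_verts
  · exact Set.disjoint_left.1 hd hx.mem_verts (mem_verts_of_adj hf).1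

theorem union_left (h : (union e f).Compatible G) (hd : Disjoint e.verts f.verts) :
    e.Compatible G where
  graph_le := le_sup_left.trans h.graph_le
  outside u w a hu hw z hz huz := by
    by_cases hzf : z ∈ f.verts
    · obtain ⟨b, hb⟩ := mem_verts_iff_exists_hasLabel.1 hzf
      exact h.adj_of_union hd hu hb (Or.inl hw) (Or.inr hb) huz
    · exact h.outside u w a (Or.inl hu) (Or.inl hw) z (fun h => h.elim hz hzf) huz
  missing u w u' w' a b hu hu' hw hw' huw hmissing := by
    refine h.missing u w u' w' a b (Or.inl hu) (Or.inl hu') (Or.inl hw) (Or.inl hw') huw ?_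
    rintro (he | hf)
    · exact hmissing he
    · exact Set.disjoint_left.1 hd hu.mem_verts (mem_verts_of_adj hf).1

theorem union_comm (h : (union e f).Compatible G) : (union f e).Compatible G where
  graph_le := by simpa only [graph, sup_comm] using h.graph_le
  outside u w a hu hw z hz := h.outside u w a hu.symm hw.symm z fun hz' => hz hz'.symm
  missing u w u' w' a b hu hu' hw hw' huw hmissing :=
    h.missing u w u' w' a b hu.symm hu'.symm hw.symm hw'.symm huw fun hadj =>
      hmissing (Or.symm hadj)

theorem of_join (h : (join i j e).Compatible G) (hwf : (join i j e).WellFormed) :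
    e.Compatible G where
  graph_le := le_sup_left.trans h.graph_le
  outside := h.outside
  missing u w u' w' a b hu hu' hw hw' huw hmissing := by
    have hjoined {u w : V} (hu : e.HasLabel u i) (hw : e.HasLabel w j) : G.Adj u w := by
      refine h.graph_le (Or.inr ⟨?_, Or.inl ⟨hu, hw⟩⟩)
      rintro rfl
      exact hwf.1 (hu.unique hwf.2 hw)
    by_cases hadj : (join i j e).graph.Adj u w
    · rcases hadj.resolve_left hmissing with ⟨-, ⟨hui, hwj⟩ | ⟨hwi, huj⟩⟩
      · obtain rfl := hu.unique hwf.2 hui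
        obtain rfl := hw.unique hwf.2 hwj
        exact hjoined hu' hw'
      · obtain rfl := hu.unique hwf.2 huj
        obtain rfl := hw.unique hwf.2 hwi
        exact (hjoined hw' hu').symm
    · exact h.missing u w u' w' a b hu hu' hw hw' huw hadj

theorem of_relabel (h : (relabel i j e).Compatible G) : e.Compatible G := by
  have hlab {u : V} {a : Fin m} (hu : e.HasLabel u a) :
      (relabel i j e).HasLabel u (if a = i then j else a) := by
    split_ifs with ha
    · exact Or.inr ⟨ha ▸ hu, rfl⟩
    · exact Or.inl ⟨hu, ha⟩
  exact ⟨h.graph_le, fun u w a hu hw => h.outside u w _ (hlab hu) (hlab hw),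
    fun u w u' w' a b hu hu' hw hw' =>
      h.missing u w u' w' _ _ (hlab hu) (hlab hu') (hlab hw) (hlab hw')⟩

theorem exists_union [Nontrivial V] (h : e.Compatible G) (hwf : e.WellFormed)
    (hv : e.verts = Set.univ) :
    ∃ e₁ e₂ : CliqueExpr V m, (union e₁ e₂).WellFormed ∧ (union e₁ e₂).verts = Set.univ ∧
      (union e₁ e₂).Compatible G := by
  induction e with
  | vertex _ v => exact (Set.singleton_ne_univ v hv).elim
  | union e f _ _ => exact ⟨e, f, hwf, hv, h⟩
  | join _ _ _ ih => exact ih (h.of_join hwf) hwf.2 hv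
  | relabel _ _ _ ih => exact ih h.of_relabel hwf hv

end Compatible

theorem verts_nonempty (e : CliqueExpr V m) : e.verts.Nonempty := by
  induction e with
  | vertex _ v => exact ⟨v, rfl⟩
  | union _ _ ihe _ => exact ihe.inl
  | join _ _ _ ih => exact ih
  | relabel _ _ _ ih => exact ih

end CliqueExpr

/-! ### Expressions for path powers -/

theorem exists_and_not_add_one {A : ℤ → Prop} {x y : ℤ} (hx : A x) (hy : ¬ A y) (hxy : x < y) :
    ∃ p, x ≤ p ∧ p < y ∧ A p ∧ ¬ A (p + 1) := by
  by_contra! hsucc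
  exact hy (Int.leInduction (motive := fun z _ => z ≤ y → A z) (fun _ => hx)
    (fun z hxz ih hzy => hsucc z hxz (by omega) (ih (by omega))) y hxy.le le_rfl)

namespace IsUnion

variable {n : ℤ} {A D : ℤ → Prop} {x y : ℤ}

theorem exists_abs_sub_le_one {k : ℤ} {L : Type*} {lab : ℤ → L} (h : IsUnion k n A D lab)
    (hcover : ∀ z, 1 ≤ z → z ≤ n → A z ∨ D z) (hx : A x) (hy : D y) :
    ∃ p q, A p ∧ D q ∧ |p - q| ≤ 1 := by
  have hxn := h.range x (Or.inl hx)
  have hyn := h.range y (Or.inr hy)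
  rcases lt_trichotomy x y with hxy | rfl | hxy
  · obtain ⟨p, hxp, hpy, hp, hq⟩ := exists_and_not_add_one hx (h.swap.disjoint y hy) hxy
    exact ⟨p, p + 1, hp, (hcover _ (by omega) (by omega)).resolve_left hq, by simp⟩
  · exact (h.disjoint x hx hy).elim
  · obtain ⟨q, hyq, hqx, hq, hp⟩ := exists_and_not_add_one hy (h.disjoint x hx) hxy
    exact ⟨q + 1, q, (hcover _ (by omega) (by omega)).resolve_right hp, hq, by simp⟩

-- The labels of two adjacent vertices in different operands are the only two labels, so the
-- vertices `1` and `4` share one of them and have a common neighbour with the other one.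
theorem exists_not_and_not_of_one_four {lab : ℤ → Fin 2} (h : IsUnion 1 4 A D lab) (hx : A x)
    (hy : D y) : ∃ z, 1 ≤ z ∧ z ≤ 4 ∧ ¬ A z ∧ ¬ D z := by
  by_contra! hcover
  replace hcover (z : ℤ) (hz : 1 ≤ z) (hz4 : z ≤ 4) : A z ∨ D z :=
    or_iff_not_imp_left.2 (hcover z hz hz4)
  obtain ⟨p, q, hp, hq, hpq⟩ := h.exists_abs_sub_le_one hcover hx hy
  have hne : lab p ≠ lab q := fun hlab => by
    have := h.far_of_lab_eq hp hq hlab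
    rw [abs_le] at hpq
    omega
  have hlab (z : ℤ) : lab z = lab p ∨ lab z = lab q := by omega
  have hnear (x y : ℤ) (hx : 1 ≤ x) (hx4 : x ≤ 4) (hy : 1 ≤ y) (hy4 : y ≤ 4)
      (hxp : lab x = lab p) (hyq : lab y = lab q) : -1 ≤ x - y ∧ x - y ≤ 1 :=
    abs_le.1 (h.cross p q x y hp hq (hcover x hx hx4) (hcover y hy hy4) hxp hyq hpq).2
  obtain ⟨hp1, hp4⟩ := h.range p (Or.inl hp)
  obtain ⟨hq1, hq4⟩ := h.range q (Or.inr hq)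
  rcases hlab 1 with h1 | h1 <;> rcases hlab 4 with h4 | h4
  · have := hnear 1 q (by omega) (by omega) hq1 hq4 h1 rfl
    have := hnear 4 q (by omega) (by omega) hq1 hq4 h4 rfl
    omega
  · have := hnear 1 4 (by omega) (by omega) (by omega) (by omega) h1 h4
    omega
  · have := hnear 4 1 (by omega) (by omega) (by omega) (by omega) h4 h1
    omega
  · have := hnear p 1 hp1 hp4 (by omega) (by omega) rfl h1
    have := hnear p 4 hp1 hp4 (by omega) (by omega) rfl h4
    omega

end IsUnion

theorem pathPower_adj_iff_abs_le {k n : ℕ} {u w : Fin n} :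
    (pathPower k n).Adj u w ↔ u ≠ w ∧ |((u : ℕ) + 1 : ℤ) - ((w : ℕ) + 1)| ≤ k := by
  rw [pathPower_adj, abs_le, ne_eq, ne_eq, Fin.ext_iff]
  omega

namespace CliqueExpr

variable {k K m n : ℕ} {e f : CliqueExpr (Fin n) m} {x : ℤ}

/-- The integer `x` is the position of a vertex of the expression, where the vertices of a path
power have the positions `1, …, n`, one more than their values in `Fin n`. -/
def Position (e : CliqueExpr (Fin n) m) (x : ℤ) : Prop :=
  ∃ u ∈ e.verts, x = ((u : ℕ) : ℤ) + 1

theorem position_add_one {u : Fin n} : e.Position ((u : ℕ) + 1) ↔ u ∈ e.verts := by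
  refine ⟨fun ⟨w, hw, huw⟩ => ?_, fun hu => ⟨u, hu, rfl⟩⟩
  obtain rfl : u = w := Fin.ext (by omega)
  exact hw

theorem position_union : (union e f).Position x ↔ e.Position x ∨ f.Position x := by
  simp only [Position, verts, Set.mem_union, or_and_right, exists_or]

theorem exists_eq_add_one (hx : 1 ≤ x) (hxn : x ≤ n) : ∃ u : Fin n, x = ((u : ℕ) : ℤ) + 1 :=
  ⟨⟨(x - 1).toNat, by omega⟩, by dsimp only; omega⟩

theorem Position.exists_hasLabel (hx : e.Position x) :
    ∃ u a, e.HasLabel u a ∧ x = ((u : ℕ) : ℤ) + 1 := by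
  obtain ⟨u, hu, rfl⟩ := hx
  obtain ⟨a, ha⟩ := mem_verts_iff_exists_hasLabel.1 hu
  exact ⟨u, a, ha, rfl⟩

theorem WellFormed.exists_lab (he : e.WellFormed) (hm : m ≤ K + 1) :
    ∃ lab : ℤ → Fin (K + 1), ∀ u a, e.HasLabel u a → lab ((u : ℕ) + 1) = Fin.castLE hm a := by
  have hlab (x : ℤ) : ∃ l : Fin (K + 1), ∀ (u : Fin n) (a : Fin m), x = (u : ℕ) + 1 →
      e.HasLabel u a → l = Fin.castLE hm a := by
    by_cases hx : e.Position x
    · obtain ⟨u, a, ha, rfl⟩ := hx.exists_hasLabel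
      refine ⟨Fin.castLE hm a, fun w b huw hb => ?_⟩
      obtain rfl : u = w := Fin.ext (by omega)
      rw [ha.unique he hb]
    · exact ⟨0, fun u a hxu ha => (hx ⟨u, ha.mem_verts, hxu⟩).elim⟩
  choose lab hlab using hlab
  exact ⟨lab, fun u a => hlab _ u a rfl⟩

namespace Compatible

theorem isUnion (h : (union e f).Compatible (pathPower k n)) (hwf : (union e f).WellFormed)
    (hm : m ≤ K + 1) : ∃ lab : ℤ → Fin (K + 1), IsUnion k n e.Position f.Position lab := by
  obtain ⟨lab, hlab⟩ := hwf.exists_lab hm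
  have hd := hwf.2.2
  have hlab_inj {u w : Fin n} {a b : Fin m} (ha : (union e f).HasLabel u a)
      (hb : (union e f).HasLabel w b) (huw : lab ((u : ℕ) + 1) = lab ((w : ℕ) + 1)) : a = b := by
    rw [hlab u a ha, hlab w b hb] at huw
    exact Fin.castLE_injective hm huw
  refine ⟨lab, ⟨?_, ?_, ?_, ?_⟩⟩
  · rintro x hx
    obtain ⟨u, -, rfl⟩ := position_union.2 hx
    omega
  · rintro _ ⟨u, hu, rfl⟩ hf
    exact Set.disjoint_left.1 hd hu (position_add_one.1 hf)
  · intro x y hx hy hxy z hz hzn hze hzf hzx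
    obtain ⟨u, a, ha, rfl⟩ := (position_union.2 hx).exists_hasLabel
    obtain ⟨w, b, hb, rfl⟩ := (position_union.2 hy).exists_hasLabel
    obtain rfl := hlab_inj ha hb hxy
    obtain ⟨v, rfl⟩ := exists_eq_add_one hz hzn
    rw [position_add_one] at hze hzf
    have hv : v ∉ (union e f).verts := not_or.2 ⟨hze, hzf⟩
    have huv : u ≠ v := by
      rintro rfl
      exact hv ha.mem_verts
    rw [abs_sub_comm] at hzx ⊢
    exact (pathPower_adj_iff_abs_le.1
      (h.outside u w a ha hb v hv (pathPower_adj_iff_abs_le.2 ⟨huv, hzx⟩))).2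
  · rintro x z x' z' hx hz hx' hz' hxx' hzz' hxz
    obtain ⟨u, a, ha, rfl⟩ := hx.exists_hasLabel
    obtain ⟨w, b, hb, rfl⟩ := hz.exists_hasLabel
    obtain ⟨u', a', ha', rfl⟩ := (position_union.2 hx').exists_hasLabel
    obtain ⟨w', b', hb', rfl⟩ := (position_union.2 hz').exists_hasLabel
    obtain rfl := hlab_inj ha' (Or.inl ha) hxx'
    obtain rfl := hlab_inj hb' (Or.inr hb) hzz'
    have huw : u ≠ w := hd.ne_of_mem ha.mem_verts hb.mem_verts
    obtain ⟨hne, hle⟩ := pathPower_adj_iff_abs_le.1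
      (h.adj_of_union hd ha hb ha' hb' (pathPower_adj_iff_abs_le.2 ⟨huw, hxz⟩))
    exact ⟨fun heq => hne (Fin.ext (by omega)), hle⟩

theorem hasGap (hc : e.Compatible (pathPower K n)) (hwf : e.WellFormed) (hK : 2 ≤ K)
    (hn : n = K * (K + 1) + 2) (hm : m ≤ K + 1) (hw : HasWindow K e.Position) :
    HasGap K n e.Position := by
  induction e with
  | vertex i v =>
    obtain ⟨j, hj⟩ := hw
    obtain ⟨_, rfl, hj0⟩ := hj j le_rfl (by omega)
    obtain ⟨_, rfl, hj1⟩ := hj (j + 1) (by omega) (by omega)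
    omega
  | union e f ihe ihf =>
    obtain ⟨lab, hu⟩ := hc.isUnion hwf hm
    have hpos : (union e f).Position = fun x => e.Position x ∨ f.Position x :=
      funext fun _ => propext position_union
    rw [hpos] at hw ⊢
    exact hu.hasGap hK (by exact_mod_cast hn) (ihe (hc.union_left hwf.2.2) hwf.1)
      (ihf (hc.union_comm.union_left hwf.2.2.symm) hwf.2.1) hw
  | join i j e ih => exact ih (hc.of_join hwf) hwf.2 hw
  | relabel i j e ih => exact ih hc.of_relabel hwf hw

end Compatible

theorem position_of_verts_eq_univ (hv : e.verts = Set.univ) (hx : 1 ≤ x) (hxn : x ≤ n) :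
    e.Position x := by
  obtain ⟨u, rfl⟩ := exists_eq_add_one hx hxn
  exact position_add_one.2 (hv ▸ Set.mem_univ u)

theorem not_defines_graphZ (hk : 2 ≤ k) (hm : m ≤ k + 1)
    (e : CliqueExpr (Fin (k * (k + 1) + 2)) m) : ¬ e.Defines (graphZ k) := by
  intro h
  have hw : HasWindow k e.Position := ⟨1, fun z hz hzk =>
    position_of_verts_eq_univ h.2.1 hz (by push_cast; nlinarith)⟩
  obtain ⟨i, hi, hin, hgap⟩ := h.compatible.hasGap h.1 hk rfl hm hw
  exact hgap i le_rfl (by omega) (position_of_verts_eq_univ h.2.1 (by omega) (by omega))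

theorem not_defines_graphZ_one (hm : m ≤ 2) (e : CliqueExpr (Fin 4) m) :
    ¬ e.Defines (graphZ 1) := by
  intro h
  obtain ⟨e₁, e₂, hwf, hv, hc⟩ := h.compatible.exists_union h.1 h.2.1
  obtain ⟨lab, hu⟩ := Compatible.isUnion (K := 1) (k := 1) (n := 4) hc hwf hm
  obtain ⟨u, hu₁⟩ := e₁.verts_nonempty
  obtain ⟨w, hw₂⟩ := e₂.verts_nonempty
  obtain ⟨z, hz, hz4, hz₁, hz₂⟩ := hu.exists_not_and_not_of_one_four
    (position_add_one.2 hu₁) (position_add_one.2 hw₂)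
  exact not_or.2 ⟨hz₁, hz₂⟩ (position_union.1 (position_of_verts_eq_univ hv hz hz4))

end CliqueExpr

theorem add_two_le_cliqueWidth_graphZ {k : ℕ} (hk : 1 ≤ k) :
    (k + 2 : ℕ) ≤ cliqueWidth (graphZ k) := by
  refine le_sInf ?_
  rintro _ ⟨m, rfl, hempty | ⟨e, he⟩⟩
  · exact (hempty.false ⟨0, by omega⟩).elim
  · rw [Nat.cast_le]
    by_contra! hm
    rcases hk.lt_or_eq with hk | rfl
    · exact e.not_defines_graphZ hk (by omega) he
    · exact e.not_defines_graphZ_one (by omega) he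

theorem mainTheorem1 (k : ℕ) :
    (∀ S : Set (Fin (k * (k + 1) + 2)), S ≠ Set.univ →
      linearCliqueWidth ((graphZ k).induce S) ≤ (k + 1 : ℕ)) ∧
    (1 ≤ k →
      (k + 2 : ℕ) ≤ cliqueWidth (graphZ k) ∧
      IsMinimalForbiddenInducedSubgraph (fun G => cliqueWidth G ≤ (k + 1 : ℕ)) (graphZ k) ∧
      IsMinimalForbiddenInducedSubgraph (fun G => linearCliqueWidth G ≤ (k + 1 : ℕ))
        (graphZ k)) := by
  refine ⟨fun S hS => linearCliqueWidth_induce_graphZ_le hS, fun hk => ?_⟩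
  have hlower := add_two_le_cliqueWidth_graphZ hk
  have hnot : ¬ cliqueWidth (graphZ k) ≤ (k + 1 : ℕ) :=
    not_le.2 (lt_of_lt_of_le (Nat.cast_lt.2 (Nat.lt_succ_self _)) hlower)
  exact ⟨hlower,
    ⟨hnot, fun S hS =>
      (cliqueWidth_le_linearCliqueWidth _).trans (linearCliqueWidth_induce_graphZ_le hS)⟩,
    ⟨fun h => hnot ((cliqueWidth_le_linearCliqueWidth _).trans h),
      fun S hS => linearCliqueWidth_induce_graphZ_le hS⟩⟩
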